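/- Let $\theta>0$. For a partition $\lambda$ (identified with its Young diagram, $|\lambda|$ boxes) let $\dim\lambda$ be the dimension of the irreducible complex representation of the symmetric group $S(|\lambda|)$ corresponding to $\lambda$. Let $M_n(\lambda)=(\dim\lambda)^2/n!$, $|\lambda|=n$, be the Plancherel measure on partitions of $n$, and let $$M^\theta(\lambda)=e^{-\theta}\sum_{n\ge 0}\frac{\theta^n}{n!}M_n(\lambda)=e^{-\theta}\theta^{|\lambda|}\left(\frac{\dim\lambda}{|\lambda|!}\right)^2$$ be its poissonization, a measure on the set of all partitions (here $M_n(\lambda)=0$ if $|\lambda|\ne n$). Let $\mathcal D(\lambda)=\{\lambda_i-i : i\ge 1\}\subset\mathbb Z$ be the descent set of $\lambda$, where $\lambda_i=0$ for $i$ larger than the number of parts, and for a finite set $X\subset\mathbb Z$ let $$\boldsymbol\varrho^\theta(X)=M^\theta\left(\{\lambda : X\subset\mathcal D(\lambda)\}\right).$$ Write $J_x=J_x(2\sqrt\theta)$ for the Bessel function of order $x$ and argument $2\sqrt\theta$, and define the discrete Bessel kernel by $$\mathsf J(x,y)=\sqrt\theta\,\frac{J_xJ_{y+1}-J_{x+1}J_y}{x-y},\qquad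 x,y\in\mathbb Z,$$ where for $x=y$ the value is the limit of the right-hand side as $y\to x$ through real $y\neq x$. Then these limits exist, and for any finite set $X=\{x_1,\dots,x_s\}\subset\mathbb Z$ $$\boldsymbol\varrho^\theta(X)=\det\big[\mathsf J(x_i,x_j)\big]_{1\le i,j\le s}.$$ -/

import Mathlib

open MeasureTheory Filter Topology

noncomputable section

namespace PoissonPlancherel

/-- The group algebra of the symmetric group of the set of boxes of the diagram `μ`
(a copy of `S(n)`, where `n = |μ|`). -/
abbrev GroupAlg (μ : YoungDiagram) : Type := MonoidAlgebra ℂ (Equiv.Perm μ.cells)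

/-- The permutations of the boxes of `μ` that preserve every row. -/
def rowPerms (μ : YoungDiagram) : Finset (Equiv.Perm μ.cells) :=
  Finset.univ.filter fun g => ∀ c : μ.cells, (g c).1.1 = c.1.1

/-- The permutations of the boxes of `μ` that preserve every column. -/
def colPerms (μ : YoungDiagram) : Finset (Equiv.Perm μ.cells) :=
  Finset.univ.filter fun g => ∀ c : μ.cells, (g c).1.2 = c.1.2

/-- The Young symmetrizer `(∑ p) * (∑ sgn(q) q)`, with `p` running over the row-preserving and
`q` over the column-preserving permutations. -/
def youngSymmetrizer (μ : YoungDiagram) : GroupAlg μ :=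
  (∑ p ∈ rowPerms μ, MonoidAlgebra.of ℂ _ p) *
    ∑ q ∈ colPerms μ, ((Equiv.Perm.sign q : ℤ) : ℂ) • MonoidAlgebra.of ℂ _ q

/-- The irreducible complex representation of the symmetric group that corresponds to `μ`
(the Specht module): the left ideal of the group algebra generated by the Young symmetrizer. -/
def spechtModule (μ : YoungDiagram) : Submodule (GroupAlg μ) (GroupAlg μ) :=
  Submodule.span (GroupAlg μ) {youngSymmetrizer μ}

/-- `dim μ`, the dimension of the irreducible representation that corresponds to `μ`. -/
def dim (μ : YoungDiagram) : ℕ := Module.finrank ℂ (spechtModule μ)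

/-- The Plancherel measure `M_n`, as a function on all diagrams: `M_n(μ) = (dim μ)² / n!` if
`|μ| = n`, and `0` otherwise. -/
def plancherel (n : ℕ) (μ : YoungDiagram) : ℝ :=
  if μ.card = n then (dim μ : ℝ) ^ 2 / (n.factorial : ℝ) else 0

/-- The weight of `μ` under the poissonized Plancherel measure,
`e^{-θ} ∑_n θ^n / n! · M_n(μ)`. -/
def poissonWeight (θ : ℝ) (μ : YoungDiagram) : ℝ :=
  Real.exp (-θ) * ∑' n : ℕ, θ ^ n / (n.factorial : ℝ) * plancherel n μ

/-- The closed form `e^{-θ} θ^{|μ|} (dim μ / |μ|!)²` of the weight. -/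
theorem poissonWeight_eq (θ : ℝ) (μ : YoungDiagram) :
    poissonWeight θ μ =
      Real.exp (-θ) * θ ^ μ.card * ((dim μ : ℝ) / (μ.card.factorial : ℝ)) ^ 2 := by
  unfold poissonWeight
  rw [tsum_eq_single μ.card]
  · simp only [plancherel, if_true]
    ring
  · intro n hn
    simp [plancherel, hn.symm]

/-- All sets of diagrams are measurable. -/
instance : MeasurableSpace YoungDiagram := ⊤

/-- The poissonized Plancherel measure `M^θ` on the set of all diagrams (partitions). -/
def poissonMeasure (θ : ℝ) : Measure YoungDiagram :=
  Measure.sum fun μ => ENNReal.ofReal (poissonWeight θ μ) • Measure.dirac μ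

/-- The descent set `{μ_i - i : i ≥ 1}`; `μ.rowLen i` is the part `μ_{i+1}`, and it is `0` beyond
the last row. -/
def descentSet (μ : YoungDiagram) : Set ℤ :=
  Set.range fun i : ℕ => (μ.rowLen i : ℤ) - ((i : ℤ) + 1)

/-- The correlation function: the probability that the descent set contains `X`. -/
def correlation (θ : ℝ) (X : Set ℤ) : ℝ :=
  (poissonMeasure θ).real {μ | X ⊆ descentSet μ}

/-- The Bessel function `J_ν(z)` of real order `ν` and argument `z > 0`, by its power series.
Mathlib's `Real.Gamma` vanishes at `0, -1, -2, …`, so that the terms with a pole of the Gamma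
function vanish, as they should. -/
def besselJ (ν z : ℝ) : ℝ :=
  ∑' m : ℕ, (-1) ^ m / ((m.factorial : ℝ) * Real.Gamma (ν + m + 1)) * (z / 2) ^ (2 * (m : ℝ) + ν)

/-- The quotient `√θ (J_x J_{y+1} - J_{x+1} J_y) / (x - y)`, with `J_x = J_x(2√θ)`, for real
`x ≠ y`. -/
def kernelQuotient (θ x y : ℝ) : ℝ :=
  √θ * ((besselJ x (2 * √θ) * besselJ (y + 1) (2 * √θ) -
    besselJ (x + 1) (2 * √θ) * besselJ y (2 * √θ)) / (x - y))

open Classical in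
/-- The discrete Bessel kernel: the quotient off the diagonal and its limit as `y → x` (through
real `y ≠ x`) on the diagonal. -/
def besselKernel (θ : ℝ) (x y : ℤ) : ℝ :=
  if x = y then limUnder (𝓝[≠] (x : ℝ)) (fun t : ℝ => kernelQuotient θ x t)
  else kernelQuotient θ x y

end PoissonPlancherel

end

open MeasureTheory Filter Topology

noncomputable section

namespace PoissonPlancherel

/-! ### Determinants of reciprocal factorials -/

/-! Put t = √θ and x_i = λ_i - i. The proof works with diagrams of at most N rows and then lets N
tend to infinity. By the dimension formula dim λ = |λ|! det[1/(x_i + j)!]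
(`dim_eq_factorial_mul_factDet`), the weight of such a diagram is e^{-θ} times the square of
det[t^{x_i+j}/(x_i+j)!]. Andréief's identity (`hasSum_det_mul_det`) then sums the weights, with a
factor 2 for each point of X in the descent set, to e^{-θ} det(G) det(1 + K_N)
(`hasSum_rowBounded_mul`). Here G is the Gram matrix of the vectors v_j = (t^{x+j}/(x+j)!)_x of
ℓ²(ℤ), 1 ≤ j ≤ N, and K_N is the block on X of the orthogonal projection onto their span. The factor
e^{-θ} det(G) is the mass of the diagrams with at most N rows and tends to 1.

The projections converge strongly to the projection onto the closed span of all v_j. With S the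
bilateral shift, v_j = exp(tS) e_{-j}. The operator exp(-tS*) is invertible and combines v_j only
with later v_{j+m}, so it preserves this closed span; it carries v_j to exp(t(S - S*)) e_{-j}. These
vectors are orthonormal because S - S* is skew-adjoint, and their coordinates are J_{x+j}(2t). So
the limit kernel is the sum over j ≥ 1 of J_{x+j} J_{y+j} (`tendsto_gram_expSeq`). The three-term
recurrence telescopes this sum to the quotient form of the Bessel kernel, and continuity in the
order gives the diagonal (`besselKernel_eq_tsum`). Expanding both sides over subsets of X isolates
the correlation functions.

The dimension formula comes from a squeeze. With f = n! det[1/(x_i + j)!] and s the number of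
standard tableaux, 0 < f ≤ s ≤ dim on diagrams of size n, the sum of s · dim is at most n!, and the
sum of f² equals n!. Hence f = dim everywhere. -/

/-- The reciprocal factorial `1 / k!`, extended by zero to the negative integers. -/
def recipFact (k : ℤ) : ℝ := (Real.Gamma (k + 1))⁻¹

theorem recipFact_of_neg {k : ℤ} (hk : k < 0) : recipFact k = 0 := by
  obtain ⟨m, rfl⟩ : ∃ m : ℕ, k = -(m + 1 : ℤ) := ⟨(-k - 1).toNat, by omega⟩
  have : ((-(m + 1 : ℤ) : ℤ) : ℝ) + 1 = -(m : ℝ) := by push_cast; ring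
  rw [recipFact, this, Real.Gamma_neg_nat_eq_zero, inv_zero]

theorem recipFact_natCast (n : ℕ) : recipFact n = ((n.factorial : ℕ) : ℝ)⁻¹ := by
  rw [recipFact, Int.cast_natCast, Real.Gamma_nat_eq_factorial]

@[simp] theorem recipFact_zero : recipFact 0 = 1 := by simpa using recipFact_natCast 0

@[simp] theorem recipFact_one : recipFact 1 = 1 := by simpa using recipFact_natCast 1

theorem self_mul_inv_Gamma_add_one (s : ℝ) : s * (Real.Gamma (s + 1))⁻¹ = (Real.Gamma s)⁻¹ := by
  rcases eq_or_ne s 0 with rfl | hs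
  · simp [Real.Gamma_zero]
  · rw [Real.Gamma_add_one hs, mul_inv, ← mul_assoc, mul_inv_cancel₀ hs, one_mul]

theorem mul_recipFact (k : ℤ) : (k : ℝ) * recipFact k = recipFact (k - 1) := by
  rw [recipFact, recipFact, self_mul_inv_Gamma_add_one]
  push_cast
  ring_nf

/-- Expansion along the replaced row turns each term into a diagonal entry of M' · adj M. The column
version below has the same value, which allows row replacements to be traded for column
replacements. -/
theorem sum_det_updateRow {n : Type*} [Fintype n] [DecidableEq n] (M M' : Matrix n n ℝ) :
    ∑ i, (M.updateRow i (M' i)).det = (M' * M.adjugate).trace := by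
  simp only [Matrix.trace, Matrix.diag, ← Matrix.cramer_transpose_apply]
  refine Finset.sum_congr rfl fun i _ => ?_
  rw [Matrix.cramer_eq_adjugate_mulVec, ← Matrix.adjugate_transpose, Matrix.mulVec_transpose]
  rfl

theorem sum_det_updateCol {n : Type*} [Fintype n] [DecidableEq n] (M M' : Matrix n n ℝ) :
    ∑ i, (M.updateCol i fun k => M' k i).det = (M' * M.adjugate).trace := by
  rw [Matrix.trace_mul_comm]
  simp only [Matrix.trace, Matrix.diag, ← Matrix.cramer_apply]
  refine Finset.sum_congr rfl fun i _ => ?_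
  rw [Matrix.cramer_eq_adjugate_mulVec]
  rfl

theorem sum_det_updateRow_mul {n : Type*} [Fintype n] [DecidableEq n] (M B : Matrix n n ℝ) :
    ∑ i, (M.updateRow i ((M * B) i)).det = B.trace * M.det := by
  rw [sum_det_updateRow, Matrix.mul_assoc, Matrix.trace_mul_comm, Matrix.mul_assoc,
    Matrix.adjugate_mul, Matrix.mul_smul, Matrix.mul_one, Matrix.trace_smul, smul_eq_mul, mul_comm]

/-- The matrix of reciprocal factorials `1 / (x_i + j)!`, `j = 1, …, N`. -/
def factMatrix {N : ℕ} (x : Fin N → ℤ) : Matrix (Fin N) (Fin N) ℝ :=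
  Matrix.of fun i j => recipFact (x i + ((j : ℕ) : ℤ) + 1)

/-- The determinant `det [1 / (x_i + j)!]`. -/
def factDet {N : ℕ} (x : Fin N → ℤ) : ℝ := (factMatrix x).det

theorem factDet_comp_perm {N : ℕ} (x : Fin N → ℤ) (σ : Equiv.Perm (Fin N)) :
    factDet (x ∘ σ) = (Equiv.Perm.sign σ : ℤ) * factDet x :=
  Matrix.det_permute σ (factMatrix x)

theorem injective_of_factDet_ne_zero {N : ℕ} {x : Fin N → ℤ} (h : factDet x ≠ 0) :
    Function.Injective x := by
  intro i j hij
  by_contra hne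
  exact h (Matrix.det_zero_of_row_eq hne (by ext k; simp [factMatrix, hij]))

theorem neg_le_of_factDet_ne_zero {N : ℕ} {x : Fin N → ℤ} (h : factDet x ≠ 0) (i : Fin N) :
    -(N : ℤ) ≤ x i := by
  by_contra! hlt
  refine h (Matrix.det_eq_zero_of_row_eq_zero i fun j => recipFact_of_neg ?_)
  have := j.isLt
  omega

theorem factMatrix_update {N : ℕ} (x : Fin N → ℤ) (i : Fin N) (a : ℤ) :
    factMatrix (Function.update x i a) =
      (factMatrix x).updateRow i fun j => recipFact (a + ((j : ℕ) : ℤ) + 1) := by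
  ext k j
  by_cases hk : k = i
  · subst hk; simp [factMatrix]
  · simp [factMatrix, Matrix.updateRow_ne, hk]

/-- The sum of `λ_i = x_i + i`. -/
def weight {N : ℕ} (x : Fin N → ℤ) : ℤ := ∑ i, (x i + ((i : ℕ) : ℤ) + 1)

/-- Since 1/(k-1)! = k/k! with k = x_i + j, the lowered row is x_i times the old row plus the old
row times diag(j). The second parts contribute the trace of diag(j), so the eigenvalue is the sum of
all x_i + i. -/
theorem sum_factDet_update_sub_one {N : ℕ} (x : Fin N → ℤ) :
    ∑ i, factDet (Function.update x i (x i - 1)) = weight x * factDet x := by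
  have key : ∀ i, factDet (Function.update x i (x i - 1)) = (x i : ℝ) * factDet x +
      ((factMatrix x).updateRow i
        ((factMatrix x * Matrix.diagonal fun j : Fin N => ((j : ℕ) : ℝ) + 1) i)).det := by
    intro i
    rw [factDet, factMatrix_update]
    have : (fun j : Fin N => recipFact (x i - 1 + ((j : ℕ) : ℤ) + 1)) =
        (x i : ℝ) • (factMatrix x) i +
          (factMatrix x * Matrix.diagonal fun j : Fin N => ((j : ℕ) : ℝ) + 1) i := by
      ext j
      have h := mul_recipFact (x i + ((j : ℕ) : ℤ) + 1)
      rw [Pi.add_apply, Pi.smul_apply, Matrix.mul_diagonal, factMatrix, Matrix.of_apply,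
        show x i - 1 + ((j : ℕ) : ℤ) + 1 = x i + ((j : ℕ) : ℤ) + 1 - 1 by ring, ← h, smul_eq_mul]
      push_cast
      ring
    rw [this, Matrix.det_updateRow_add, Matrix.det_updateRow_smul, Matrix.updateRow_eq_self,
      factDet]
  simp_rw [key]
  rw [Finset.sum_add_distrib, sum_det_updateRow_mul, Matrix.trace_diagonal, ← Finset.sum_mul,
    factDet, ← add_mul, ← Finset.sum_add_distrib, weight]
  push_cast
  congr 1
  exact Finset.sum_congr rfl fun i _ => by ring

/-- Raising x_i shifts row i by one column. After passing to column replacements, column j is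
replaced by column j + 1, so every term but the last has two equal columns. -/
theorem sum_factDet_update_add_one {N : ℕ} (x : Fin (N + 1) → ℤ)
    (hx : ∃ i, x i = -((N + 1 : ℕ) : ℤ)) :
    ∑ i, factDet (Function.update x i (x i + 1)) = factDet x := by
  obtain ⟨r, hr⟩ := hx
  let M' : Matrix (Fin (N + 1)) (Fin (N + 1)) ℝ := factMatrix fun i => x i + 1
  have h1 : ∀ i, factDet (Function.update x i (x i + 1)) =
      ((factMatrix x).updateRow i (M' i)).det :=
    fun i => by rw [factDet, factMatrix_update]; rfl
  simp_rw [h1]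
  rw [sum_det_updateRow, ← sum_det_updateCol, Fin.sum_univ_castSucc, Finset.sum_eq_zero, zero_add]
  -- In the row with the minimal value -(N+1), the earlier entries are reciprocal factorials of
  -- negative integers, and the last entry changes from 1/0! to 1/1!. The difference of the two last
  -- columns thus leaves a zero row.
  · have h2 : ((factMatrix x).updateCol (Fin.last N) ((fun k => M' k (Fin.last N)) +
        (-1 : ℝ) • fun k => factMatrix x k (Fin.last N))).det = 0 := by
      refine Matrix.det_eq_zero_of_row_eq_zero r fun j => ?_
      rcases Fin.eq_castSucc_or_eq_last j with ⟨k, rfl⟩ | rfl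
      · rw [Matrix.updateCol_ne (Fin.castSucc_lt_last k).ne]
        refine recipFact_of_neg ?_
        have := k.isLt
        simp only [Fin.val_castSucc]
        omega
      · rw [Matrix.updateCol_self]
        simp only [M', factMatrix, Pi.add_apply, Pi.smul_apply, Matrix.of_apply, hr, Fin.val_last]
        rw [show -((N + 1 : ℕ) : ℤ) + 1 + (N : ℤ) + 1 = 1 by push_cast; ring,
          show -((N + 1 : ℕ) : ℤ) + (N : ℤ) + 1 = 0 by push_cast; ring]
        simp
    rw [Matrix.det_updateCol_add, Matrix.det_updateCol_smul, Matrix.updateCol_eq_self] at h2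
    rw [factDet]
    linarith
  · intro i _
    refine Matrix.det_zero_of_column_eq (i := i.castSucc) (j := i.succ)
      (Fin.castSucc_lt_succ).ne fun k => ?_
    rw [Matrix.updateCol_self, Matrix.updateCol_ne (Fin.castSucc_lt_succ).ne']
    simp only [M', factMatrix, Matrix.of_apply, Fin.val_castSucc, Fin.val_succ]
    congr 1
    push_cast
    ring

theorem factDet_castSucc {N : ℕ} (x : Fin (N + 1) → ℤ)
    (hx : x (Fin.last N) = -((N + 1 : ℕ) : ℤ)) :
    factDet (fun i => x (Fin.castSucc i)) = factDet x := by
  rw [factDet, factDet, Matrix.det_succ_row _ (Fin.last N), Fin.sum_univ_castSucc,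
    Finset.sum_eq_zero, zero_add]
  · have : factMatrix x (Fin.last N) (Fin.last N) = 1 := by
      rw [factMatrix, Matrix.of_apply, hx, Fin.val_last,
        show -((N + 1 : ℕ) : ℤ) + (N : ℤ) + 1 = 0 by push_cast; ring, recipFact_zero]
    rw [this]
    simp only [Fin.val_last, ← two_mul, pow_mul, neg_one_sq, one_pow, one_mul, Fin.succAbove_last]
    rfl
  · intro j _
    have : factMatrix x (Fin.last N) j.castSucc = 0 := by
      refine recipFact_of_neg ?_
      have := j.isLt
      rw [hx, Fin.val_castSucc]
      omega
    rw [this]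
    simp

/-! ### Diagrams as strictly decreasing sequences -/

theorem ext_rowLen {μ ν : YoungDiagram} (h : ∀ i, μ.rowLen i = ν.rowLen i) : μ = ν := by
  ext ⟨i, j⟩
  rw [YoungDiagram.mem_cells, YoungDiagram.mem_cells, YoungDiagram.mem_iff_lt_rowLen,
    YoungDiagram.mem_iff_lt_rowLen, h]

/-- The diagram with the given row lengths. -/
def ofRowFun (g : ℕ → ℕ) (hg : Antitone g) (N : ℕ) (_hN : ∀ i, N ≤ i → g i = 0) :
    YoungDiagram where
  cells := (Finset.range N ×ˢ Finset.range (g 0)).filter fun c => c.2 < g c.1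
  isLowerSet := by
    rintro ⟨i, j⟩ ⟨i', j'⟩ ⟨hi, hj⟩ h
    simp only [Finset.coe_filter, Finset.mem_product, Finset.mem_range, Set.mem_ofPred_eq] at h ⊢
    have h1 : g i ≤ g i' := hg hi
    simp only at hi hj
    omega

theorem rowLen_ofRowFun (g : ℕ → ℕ) (hg : Antitone g) (N : ℕ) (hN : ∀ i, N ≤ i → g i = 0)
    (i : ℕ) : (ofRowFun g hg N hN).rowLen i = g i := by
  refine eq_of_forall_lt_iff fun j => ?_
  rw [← YoungDiagram.mem_iff_lt_rowLen, ← YoungDiagram.mem_cells]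
  simp only [ofRowFun, Finset.mem_filter, Finset.mem_product, Finset.mem_range]
  refine ⟨fun h => h.2, fun h => ⟨⟨?_, h.trans_le (hg (Nat.zero_le i))⟩, h⟩⟩
  by_contra! hi
  rw [hN i hi] at h
  omega

theorem rowLen_eq_zero_of_le {μ : YoungDiagram} {N i : ℕ} (hμ : μ.rowLen N = 0) (hi : N ≤ i) :
    μ.rowLen i = 0 :=
  Nat.le_zero.1 (hμ ▸ μ.rowLen_anti N i hi)

theorem sum_rowLen (μ : YoungDiagram) {N : ℕ} (hμ : μ.rowLen N = 0) :
    ∑ i : Fin N, μ.rowLen i = μ.card := by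
  rw [Fin.sum_univ_eq_sum_range fun i => μ.rowLen i, YoungDiagram.card,
    Finset.card_eq_sum_card_fiberwise (f := Prod.fst) (t := Finset.range N)]
  · exact Finset.sum_congr rfl fun i _ => μ.rowLen_eq_card
  · rintro ⟨i, j⟩ h
    rw [Finset.mem_coe, YoungDiagram.mem_cells, YoungDiagram.mem_iff_lt_rowLen] at h
    by_contra hi
    simp only [Finset.coe_range, Set.mem_Iio, not_lt] at hi
    rw [rowLen_eq_zero_of_le hμ hi] at h
    omega

theorem rowLen_eq_zero_of_card_le {μ : YoungDiagram} {N : ℕ} (h : μ.card ≤ N) :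
    μ.rowLen N = 0 := by
  by_contra hne
  have hsub : (Finset.range (N + 1)).image (fun i => (i, 0)) ⊆ μ.cells := by
    intro c hc
    obtain ⟨i, hi, rfl⟩ := Finset.mem_image.1 hc
    rw [YoungDiagram.mem_cells, YoungDiagram.mem_iff_lt_rowLen]
    have := μ.rowLen_anti i N (by simpa [Nat.lt_succ_iff] using hi)
    omega
  have := Finset.card_le_card hsub
  rw [Finset.card_image_of_injective _ fun a b h => congrArg Prod.fst h, Finset.card_range] at this
  exact absurd (this.trans h) (by omega)

/-- The first `N` elements of the descent set, in decreasing order. -/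
def descents (N : ℕ) (μ : YoungDiagram) : Fin N → ℤ :=
  fun i => (μ.rowLen i : ℤ) - (((i : ℕ) : ℤ) + 1)

theorem descents_strictAnti (N : ℕ) (μ : YoungDiagram) : StrictAnti (descents N μ) := by
  intro i j hij
  have := μ.rowLen_anti i j hij.le
  have : (i : ℕ) < j := hij
  simp only [descents]
  omega

theorem weight_descents {N : ℕ} {μ : YoungDiagram} (hμ : μ.rowLen N = 0) :
    weight (descents N μ) = μ.card := by
  rw [← sum_rowLen μ hμ, weight]
  push_cast
  exact Finset.sum_congr rfl fun i _ => by rw [descents]; ring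

theorem eq_of_descents_eq {N : ℕ} {μ ν : YoungDiagram} (hμ : μ.rowLen N = 0)
    (hν : ν.rowLen N = 0) (h : descents N μ = descents N ν) : μ = ν := by
  refine ext_rowLen fun i => ?_
  rcases lt_or_ge i N with hi | hi
  · have := congrFun h ⟨i, hi⟩
    simp only [descents] at this
    omega
  · rw [rowLen_eq_zero_of_le hμ hi, rowLen_eq_zero_of_le hν hi]

theorem exists_descents_eq {N : ℕ} {x : Fin N → ℤ} (hx : StrictAnti x) (h0 : ∀ i, -(N : ℤ) ≤ x i) :
    ∃ μ : YoungDiagram, μ.rowLen N = 0 ∧ descents N μ = x := by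
  let y : ℕ → ℤ := fun i => if h : i < N then x ⟨i, h⟩ + (i + 1) else 0
  have hy : Antitone y := by
    refine antitone_nat_of_succ_le fun i => ?_
    simp only [y]
    by_cases h1 : i + 1 < N
    · have := hx (show (⟨i, by omega⟩ : Fin N) < ⟨i + 1, h1⟩ from Nat.lt_succ_self i)
      rw [dif_pos h1, dif_pos (by omega)]
      push_cast
      omega
    · rw [dif_neg h1]
      split_ifs with h2
      · have := h0 ⟨i, h2⟩
        omega
      · rfl
  -- An antitone sequence that is zero from N on is nonnegative; compare the places i and i + N.
  have hy0 : ∀ i, 0 ≤ y i := fun i => by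
    have h := hy (Nat.le_add_right i N)
    simpa [y] using h
  have hN : ∀ i, N ≤ i → (y i).toNat = 0 := fun i hi => by simp [y, hi.not_gt]
  have hanti : Antitone fun i => (y i).toNat := fun i j h => Int.toNat_le_toNat (hy h)
  refine ⟨ofRowFun _ hanti N hN, ?_, ?_⟩
  · rw [rowLen_ofRowFun]
    exact hN N le_rfl
  · ext i
    rw [descents, rowLen_ofRowFun, Int.toNat_of_nonneg (hy0 _)]
    simp [y]

/-! ### From symmetric sums over integer sequences to sums over diagrams -/

/-- The diagrams with at most `N` rows. -/
abbrev RowBounded (N : ℕ) : Type := {μ : YoungDiagram // μ.rowLen N = 0}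

/-- The permuted descent sequence. -/
def permDescents (N : ℕ) (p : RowBounded N × Equiv.Perm (Fin N)) : Fin N → ℤ :=
  descents N p.1.1 ∘ p.2

theorem permDescents_injective (N : ℕ) : Function.Injective (permDescents N) := by
  rintro ⟨⟨μ, hμ⟩, σ⟩ ⟨⟨ν, hν⟩, τ⟩ h
  simp only [permDescents] at h
  have h1 : descents N μ = (descents N μ ∘ σ) ∘ (σ⁻¹ : Equiv.Perm (Fin N)) := by ext; simp
  have h2 : descents N ν = (descents N μ ∘ σ) ∘ (τ⁻¹ : Equiv.Perm (Fin N)) := by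
    rw [h]; ext; simp
  have h3 : descents N μ = descents N ν := by
    rw [h1, h2]
    refine Tuple.unique_antitone ?_ ?_
    · rw [← h1]; exact (descents_strictAnti N μ).antitone
    · rw [← h2]; exact (descents_strictAnti N ν).antitone
  obtain rfl := eq_of_descents_eq hμ hν h3
  have h4 : σ = τ := by
    ext i
    exact congrArg _ ((descents_strictAnti N μ).injective (congrFun h i))
  rw [h4]

theorem mem_range_permDescents {N : ℕ} {x : Fin N → ℤ} (hx : Function.Injective x)
    (h0 : ∀ i, -(N : ℤ) ≤ x i) : x ∈ Set.range (permDescents N) := by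
  let s := Tuple.sort fun i => -x i
  have hs : StrictAnti (x ∘ s) := by
    refine Antitone.strictAnti_of_injective (fun i j hij => ?_) (hx.comp s.injective)
    have := Tuple.monotone_sort (fun i => -x i) hij
    simp only [Function.comp_apply, neg_le_neg_iff] at this
    exact this
  obtain ⟨μ, hμ, h⟩ := exists_descents_eq hs fun i => h0 _
  refine ⟨(⟨μ, hμ⟩, s⁻¹), ?_⟩
  simp only [permDescents, h]
  ext; simp

/-- The support consists of injective sequences bounded below by -N, and each of these is a unique
rearrangement of the descents of a unique diagram. A symmetric function is therefore counted N!
times per diagram. -/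
theorem hasSum_descents_of_hasSum {N : ℕ} {F : (Fin N → ℤ) → ℝ} {s : ℝ} (hF : HasSum F s)
    (hsymm : ∀ x (σ : Equiv.Perm (Fin N)), F (x ∘ σ) = F x)
    (hsupp : ∀ x, F x ≠ 0 → Function.Injective x ∧ ∀ i, -(N : ℤ) ≤ x i) :
    HasSum (fun μ : RowBounded N => (N.factorial : ℝ) * F (descents N μ)) s := by
  have h1 : HasSum (F ∘ permDescents N) s := by
    refine ((permDescents_injective N).hasSum_iff fun x hx => ?_).2 hF
    by_contra hne
    exact hx (mem_range_permDescents (hsupp x hne).1 (hsupp x hne).2)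
  refine HasSum.prod_fiberwise h1 fun μ => ?_
  have : (fun σ : Equiv.Perm (Fin N) => (F ∘ permDescents N) (μ, σ)) =
      fun _ => F (descents N μ) := by
    ext σ
    exact hsymm _ _
  rw [this]
  convert! hasSum_fintype (fun _ : Equiv.Perm (Fin N) => F (descents N μ)) using 1
  simp [Fintype.card_perm]

theorem factDet_sq_symm {N : ℕ} (x : Fin N → ℤ) (σ : Equiv.Perm (Fin N)) :
    factDet (x ∘ σ) ^ 2 = factDet x ^ 2 := by
  rw [factDet_comp_perm, mul_pow]
  rcases Int.units_eq_one_or (Equiv.Perm.sign σ) with h | h <;> simp [h]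

theorem weight_comp_perm {N : ℕ} (x : Fin N → ℤ) (σ : Equiv.Perm (Fin N)) :
    weight (x ∘ σ) = weight x := by
  simp only [weight, Finset.sum_add_distrib, Function.comp_apply, Equiv.sum_comp σ x]

theorem weight_update {N : ℕ} (x : Fin N → ℤ) (i : Fin N) (a : ℤ) :
    weight (Function.update x i (x i + a)) = weight x + a := by
  have : ∀ j, Function.update x i (x i + a) j = x j + if j = i then a else 0 := by
    intro j
    by_cases h : j = i
    · subst h; simp
    · simp [h]
  simp only [weight, this, Finset.sum_add_distrib, Finset.sum_ite_eq', Finset.mem_univ, if_true]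
  ring

theorem le_weight_of_neg_le {N : ℕ} {x : Fin N → ℤ} (h0 : ∀ i, -(N : ℤ) ≤ x i) (i : Fin N) :
    x i ≤ weight x + N ^ 2 := by
  have h2 : ∀ j : Fin N, x j + (N : ℤ) ≤ x j + ((j : ℕ) : ℤ) + 1 + N := fun j => by omega
  have h1 : x i + (N : ℤ) ≤ ∑ j, (x j + ((j : ℕ) : ℤ) + 1 + N) :=
    (h2 i).trans (Finset.single_le_sum (f := fun j : Fin N => x j + ((j : ℕ) : ℤ) + 1 + N)
      (fun j _ => by have := h0 j; omega) (Finset.mem_univ i))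
  rw [Finset.sum_add_distrib, ← weight] at h1
  simp only [Finset.sum_const, Finset.card_univ, Fintype.card_fin, nsmul_eq_mul] at h1
  nlinarith

theorem finite_factDet_ne_zero (N : ℕ) (n : ℤ) :
    {x : Fin N → ℤ | weight x = n ∧ factDet x ≠ 0}.Finite := by
  refine (Set.finite_Icc (fun _ => -(N : ℤ)) (fun _ : Fin N => n + N ^ 2)).subset ?_
  rintro x ⟨rfl, h⟩
  have h0 := neg_le_of_factDet_ne_zero h
  exact ⟨h0, le_weight_of_neg_le h0⟩

/-- With fewer than N boxes the N-th row is empty, so its descent takes the minimal value. This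
supplies the hypothesis of the raising identity. -/
theorem exists_eq_neg_of_weight_lt {N : ℕ} {x : Fin N → ℤ} (h : factDet x ≠ 0)
    (hw : weight x < N) : ∃ i, x i = -(N : ℤ) := by
  by_contra! hne
  have h0 := neg_le_of_factDet_ne_zero h
  obtain ⟨⟨⟨μ, hμ⟩, σ⟩, rfl⟩ := mem_range_permDescents (injective_of_factDet_ne_zero h) h0
  rw [permDescents, weight_comp_perm, weight_descents hμ] at hw
  have : 0 < N := by omega
  have h1 := hne (σ⁻¹ ⟨N - 1, by omega⟩)
  have h2 : μ.rowLen (N - 1) = 0 := rowLen_eq_zero_of_card_le (by omega)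
  simp [permDescents, descents, h2] at h1
  omega

theorem factDet_descents_bot (N : ℕ) : factDet (descents N ⊥) = 1 := by
  have h0 : ∀ i, (⊥ : YoungDiagram).rowLen i = 0 := fun i => by
    by_contra h
    exact YoungDiagram.notMem_bot (i, 0) (YoungDiagram.mem_iff_lt_rowLen.2 (Nat.pos_of_ne_zero h))
  rw [factDet, Matrix.det_of_isUpperTriangular]
  · refine Finset.prod_eq_one fun i _ => ?_
    simp [factMatrix, descents, h0]
  · intro i j hij
    refine recipFact_of_neg ?_
    have : (j : ℕ) < i := hij
    rw [descents, h0]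
    omega

theorem card_eq_zero_iff_eq_bot {μ : YoungDiagram} : μ.card = 0 ↔ μ = ⊥ := by
  rw [YoungDiagram.card, Finset.card_eq_zero]
  constructor
  · intro h
    ext c
    rw [h, YoungDiagram.cells_bot]
  · rintro rfl
    exact YoungDiagram.cells_bot

/-! ### The total squared determinant at a given weight -/

theorem summable_of_weight {N : ℕ} (n : ℤ) (f : (Fin N → ℤ) → ℝ) :
    Summable fun x : Fin N → ℤ => if weight x = n then factDet x * f x else 0 := by
  refine summable_of_hasFiniteSupport ((finite_factDet_ne_zero N n).subset fun x hx => ?_)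
  simp only [Function.mem_support, ne_eq, ite_eq_right_iff, not_forall] at hx
  exact ⟨hx.1, left_ne_zero_of_mul hx.2⟩

/-- The total squared determinant over the sequences of given weight. -/
def squareSum (N n : ℕ) : ℝ := ∑' x : Fin N → ℤ, if weight x = n then factDet x * factDet x else 0

/-- Lowering and raising are adjoint under x ↦ x + e_i. Lowering multiplies by n + 1 at weight n +
1, while raising acts as the identity at weight n < N. -/
theorem squareSum_succ {N n : ℕ} (hn : n < N) :
    ((n : ℝ) + 1) * squareSum N (n + 1) = squareSum N n := by
  obtain ⟨N, rfl⟩ : ∃ M, N = M + 1 := ⟨N - 1, by omega⟩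
  let e : Fin (N + 1) → (Fin (N + 1) → ℤ) ≃ (Fin (N + 1) → ℤ) := fun i =>
    { toFun := fun x => Function.update x i (x i + 1)
      invFun := fun x => Function.update x i (x i - 1)
      left_inv := fun x => by simp
      right_inv := fun x => by simp }
  have h1 : ((n : ℝ) + 1) * squareSum (N + 1) (n + 1) = ∑ i, ∑' x : Fin (N + 1) → ℤ,
      if weight x = ((n + 1 : ℕ) : ℤ) then factDet x * factDet (Function.update x i (x i - 1))
        else 0 := by
    rw [squareSum, ← tsum_mul_left, ← Summable.tsum_finsetSum fun i _ => summable_of_weight _ _]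
    refine tsum_congr fun x => ?_
    split_ifs with h
    · rw [← Finset.mul_sum, sum_factDet_update_sub_one, h]
      push_cast
      ring
    · simp
  have h2 : squareSum (N + 1) n = ∑ i, ∑' x : Fin (N + 1) → ℤ,
      if weight x = (n : ℤ) then factDet x * factDet (Function.update x i (x i + 1)) else 0 := by
    rw [squareSum, ← Summable.tsum_finsetSum fun i _ => summable_of_weight _ _]
    refine tsum_congr fun x => ?_
    split_ifs with h
    · rw [← Finset.mul_sum]
      rcases eq_or_ne (factDet x) 0 with h0 | h0
      · simp [h0]
      · rw [sum_factDet_update_add_one x (exists_eq_neg_of_weight_lt h0 (by omega))]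
    · simp
  rw [h1, h2]
  refine Finset.sum_congr rfl fun i _ => ?_
  rw [← (e i).tsum_eq]
  refine tsum_congr fun x => ?_
  have hw : weight (e i x) = weight x + 1 := weight_update x i 1
  have hx : Function.update (e i x) i (e i x i - 1) = x := (e i).left_inv x
  rw [hx, hw, mul_comm]
  push_cast
  simp only [add_left_inj]
  rfl

theorem hasSum_squareSum (N n : ℕ) : HasSum (fun μ : RowBounded N =>
    (N.factorial : ℝ) * if μ.1.card = n then factDet (descents N μ) ^ 2 else 0)
      (squareSum N n) := by
  have h := hasSum_descents_of_hasSum (summable_of_weight (N := N) n factDet).hasSum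
    (fun x σ => by
      rw [weight_comp_perm, ← sq, ← sq, factDet_sq_symm])
    (fun x hx => by
      simp only [ne_eq, ite_eq_right_iff, not_forall] at hx
      have := left_ne_zero_of_mul hx.2
      exact ⟨injective_of_factDet_ne_zero this, neg_le_of_factDet_ne_zero this⟩)
  convert! h using 3 with μ
  simp only [weight_descents μ.2, Nat.cast_inj, sq]

theorem squareSum_eq {N n : ℕ} (hn : n ≤ N) :
    squareSum N n = (N.factorial : ℝ) / (n.factorial : ℝ) := by
  induction n with
  | zero =>
    have h := hasSum_squareSum N 0
    have hb : (⊥ : YoungDiagram).rowLen N = 0 := rowLen_eq_zero_of_card_le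
      ((card_eq_zero_iff_eq_bot.2 rfl).trans_le (Nat.zero_le N))
    refine h.unique ?_
    have h1 := hasSum_single (f := fun μ : RowBounded N => (N.factorial : ℝ) *
      if μ.1.card = 0 then factDet (descents N μ) ^ 2 else 0) ⟨⊥, hb⟩ ?_
    · simpa [factDet_descents_bot, card_eq_zero_iff_eq_bot] using h1
    · intro μ hμ
      rw [if_neg, mul_zero]
      rw [card_eq_zero_iff_eq_bot]
      exact fun h => hμ (Subtype.ext h)
  | succ n ih =>
    have h := squareSum_succ (N := N) (n := n) (by omega)
    rw [ih (by omega)] at h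
    have h1 : ((n : ℝ) + 1) ≠ 0 := by positivity
    rw [Nat.factorial_succ]
    have h2 : (n.factorial : ℝ) ≠ 0 := by positivity
    field_simp at h ⊢
    push_cast
    linarith

theorem hasSum_factDet_sq {N n : ℕ} (hn : n ≤ N) : HasSum (fun μ : RowBounded N =>
    if μ.1.card = n then factDet (descents N μ) ^ 2 else 0) (1 / (n.factorial : ℝ)) := by
  have h0 : (N.factorial : ℝ) ≠ 0 := by positivity
  have h := (hasSum_squareSum N n).mul_left (N.factorial : ℝ)⁻¹
  simp only [inv_mul_cancel_left₀ h0] at h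
  convert! h using 1
  rw [squareSum_eq hn]
  field_simp

theorem factDet_descents_succ {N : ℕ} {μ : YoungDiagram} (hμ : μ.rowLen N = 0) :
    factDet (descents (N + 1) μ) = factDet (descents N μ) := by
  rw [← factDet_castSucc]
  · rfl
  · simp [descents, hμ]

theorem factDet_descents_of_le {N M : ℕ} {μ : YoungDiagram} (hμ : μ.rowLen N = 0) (h : N ≤ M) :
    factDet (descents M μ) = factDet (descents N μ) := by
  induction M, h using Nat.le_induction with
  | base => rfl
  | succ M hM ih => rw [factDet_descents_succ (rowLen_eq_zero_of_le hμ hM), ih]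

/-! ### Young symmetrizers -/

section Symmetrizer

variable {α β : Type*} [Fintype α] [DecidableEq α] [Fintype β] [DecidableEq β]

/-- The permutations that preserve the function `r`. -/
def fiberPerms (r : α → ℕ) : Finset (Equiv.Perm α) :=
  Finset.univ.filter fun g => ∀ a, r (g a) = r a

theorem mem_fiberPerms {r : α → ℕ} {g : Equiv.Perm α} : g ∈ fiberPerms r ↔ ∀ a, r (g a) = r a := by
  simp [fiberPerms]

theorem inv_mem_fiberPerms {r : α → ℕ} {g : Equiv.Perm α} (h : g ∈ fiberPerms r) :
    g⁻¹ ∈ fiberPerms r := by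
  rw [mem_fiberPerms] at h ⊢
  intro a
  simpa using (h (g⁻¹ a)).symm

theorem mul_mem_fiberPerms {r : α → ℕ} {g g' : Equiv.Perm α} (h : g ∈ fiberPerms r)
    (h' : g' ∈ fiberPerms r) : g * g' ∈ fiberPerms r := by
  rw [mem_fiberPerms] at *
  intro a
  rw [Equiv.Perm.mul_apply, h, h']

theorem swap_mem_fiberPerms {r : α → ℕ} {a b : α} (h : r a = r b) :
    Equiv.swap a b ∈ fiberPerms r := by
  rw [mem_fiberPerms]
  intro k
  rw [Equiv.swap_apply_def]
  split_ifs with h1 h2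
  · rw [h1, h]
  · rw [h2, h]
  · rfl

/-- The sum of the permutations that preserve `r`. -/
def rowSum (r : α → ℕ) : MonoidAlgebra ℂ (Equiv.Perm α) :=
  ∑ p ∈ fiberPerms r, MonoidAlgebra.of ℂ _ p

/-- The signed sum of the permutations that preserve `c`. -/
def colSum (c : α → ℕ) : MonoidAlgebra ℂ (Equiv.Perm α) :=
  ∑ q ∈ fiberPerms c, ((Equiv.Perm.sign q : ℤ) : ℂ) • MonoidAlgebra.of ℂ _ q

/-- The Young symmetrizer of a filling with row function `r` and column function `c`. -/
def youngElt (r c : α → ℕ) : MonoidAlgebra ℂ (Equiv.Perm α) := rowSum r * colSum c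

theorem of_mul_rowSum {r : α → ℕ} {g : Equiv.Perm α} (h : g ∈ fiberPerms r) :
    MonoidAlgebra.of ℂ _ g * rowSum r = rowSum r := by
  rw [rowSum, Finset.mul_sum]
  refine Finset.sum_equiv (Equiv.mulLeft g) (fun p => ?_) fun p _ => (map_mul _ g p).symm
  refine ⟨fun hp => mul_mem_fiberPerms h hp, fun hp => ?_⟩
  simpa using mul_mem_fiberPerms (inv_mem_fiberPerms h) hp

theorem sign_mul_self (g : Equiv.Perm α) :
    ((Equiv.Perm.sign g : ℤ) : ℂ) * ((Equiv.Perm.sign g : ℤ) : ℂ) = 1 := by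
  rcases Int.units_eq_one_or (Equiv.Perm.sign g) with h | h <;> simp [h]

theorem colSum_mul_of {c : α → ℕ} {g : Equiv.Perm α} (h : g ∈ fiberPerms c) :
    colSum c * MonoidAlgebra.of ℂ _ g = ((Equiv.Perm.sign g : ℤ) : ℂ) • colSum c := by
  rw [colSum, Finset.sum_mul, Finset.smul_sum]
  refine Finset.sum_equiv (Equiv.mulRight g) (fun p => ?_) fun p _ => ?_
  · refine ⟨fun hp => mul_mem_fiberPerms hp h, fun hp => ?_⟩
    simpa using mul_mem_fiberPerms hp (inv_mem_fiberPerms h)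
  · rw [Equiv.coe_mulRight, map_mul, smul_smul, map_mul, smul_mul_assoc]
    push_cast
    rw [mul_left_comm, sign_mul_self, mul_one]

/-- The transposition of a and b can be inserted between the factors: the row sum absorbs it, the
column sum changes sign. -/
theorem colSum_mul_rowSum_eq_zero {c r : α → ℕ} {a b : α} (hab : a ≠ b) (hc : c a = c b)
    (hr : r a = r b) : colSum c * rowSum r = 0 := by
  have h : colSum c * rowSum r = -(colSum c * rowSum r) := by
    conv_lhs => rw [← of_mul_rowSum (swap_mem_fiberPerms hr), ← mul_assoc,
      colSum_mul_of (swap_mem_fiberPerms hc)]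
    simp [Equiv.Perm.sign_swap hab]
  have h2 : (2 : ℂ) • (colSum c * rowSum r) = 0 := by
    rw [two_smul]
    nth_rewrite 1 [h]
    exact neg_add_cancel _
  exact (smul_eq_zero.1 h2).resolve_left two_ne_zero

theorem youngElt_mul_youngElt_eq_zero {r c r' c' : α → ℕ} {a b : α} (hab : a ≠ b)
    (hc : c a = c b) (hr : r' a = r' b) : youngElt r c * youngElt r' c' = 0 := by
  rw [youngElt, youngElt, mul_assoc, ← mul_assoc (colSum c), colSum_mul_rowSum_eq_zero hab hc hr,
    zero_mul, mul_zero]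

theorem rowSum_mul_self (r : α → ℕ) :
    rowSum r * rowSum r = ((fiberPerms r).card : ℂ) • rowSum r := by
  conv_lhs => enter [1]; rw [rowSum]
  rw [Finset.sum_mul, Finset.sum_congr rfl fun g hg => of_mul_rowSum hg, Finset.sum_const,
    Nat.cast_smul_eq_nsmul]

theorem colSum_mul_self (c : α → ℕ) :
    colSum c * colSum c = ((fiberPerms c).card : ℂ) • colSum c := by
  conv_lhs => enter [2]; rw [colSum]
  rw [Finset.mul_sum, Finset.sum_congr rfl (g := fun _ => colSum c), Finset.sum_const,
    Nat.cast_smul_eq_nsmul]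
  intro g hg
  rw [mul_smul_comm, colSum_mul_of hg, smul_smul, sign_mul_self, one_smul]

/-! ### Positivity: Young symmetrizers are not nilpotent -/

/-- The standard Hermitian form of the group algebra. -/
def groupInner (x y : MonoidAlgebra ℂ (Equiv.Perm α)) : ℂ :=
  ∑ g, x.coeff g * starRingEnd ℂ (y.coeff g)

theorem eq_zero_of_groupInner_self {x : MonoidAlgebra ℂ (Equiv.Perm α)}
    (h : groupInner x x = 0) : x = 0 := by
  have h1 : ∑ g, Complex.normSq (x.coeff g) = 0 := by
    have : groupInner x x = ((∑ g, Complex.normSq (x.coeff g) : ℝ) : ℂ) := by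
      simp [groupInner, Complex.mul_conj]
    rw [this] at h
    exact_mod_cast h
  rw [Finset.sum_eq_zero_iff_of_nonneg fun g _ => Complex.normSq_nonneg _] at h1
  ext g
  simpa using h1 g (Finset.mem_univ g)

theorem groupInner_zero_left (y : MonoidAlgebra ℂ (Equiv.Perm α)) : groupInner 0 y = 0 := by
  simp [groupInner]

theorem groupInner_smul_left (k : ℂ) (x y : MonoidAlgebra ℂ (Equiv.Perm α)) :
    groupInner (k • x) y = k * groupInner x y := by
  simp [groupInner, Finset.mul_sum, mul_assoc]

theorem groupInner_sum_left {ι : Type*} (s : Finset ι) (f : ι → MonoidAlgebra ℂ (Equiv.Perm α))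
    (y : MonoidAlgebra ℂ (Equiv.Perm α)) :
    groupInner (∑ i ∈ s, f i) y = ∑ i ∈ s, groupInner (f i) y := by
  simp only [groupInner, MonoidAlgebra.coeff_sum, Finset.sum_apply', Finset.sum_mul]
  exact Finset.sum_comm

theorem groupInner_sum_right {ι : Type*} (s : Finset ι) (f : ι → MonoidAlgebra ℂ (Equiv.Perm α))
    (x : MonoidAlgebra ℂ (Equiv.Perm α)) :
    groupInner x (∑ i ∈ s, f i) = ∑ i ∈ s, groupInner x (f i) := by
  simp only [groupInner, MonoidAlgebra.coeff_sum, Finset.sum_apply', map_sum, Finset.mul_sum]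
  exact Finset.sum_comm

theorem groupInner_mul_of (x y : MonoidAlgebra ℂ (Equiv.Perm α)) (g : Equiv.Perm α) :
    groupInner (x * MonoidAlgebra.of ℂ _ g) y = groupInner x (y * MonoidAlgebra.of ℂ _ g⁻¹) := by
  simp only [groupInner, MonoidAlgebra.of_apply, MonoidAlgebra.coeff_mul_single_apply, mul_one,
    inv_inv]
  exact Fintype.sum_equiv (Equiv.mulRight g⁻¹) _ _ fun k => by simp

theorem groupInner_mul_smul_of (x y : MonoidAlgebra ℂ (Equiv.Perm α)) (g : Equiv.Perm α) (k : ℤ) :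
    groupInner (x * ((k : ℂ) • MonoidAlgebra.of ℂ _ g)) y =
      groupInner x (y * ((k : ℂ) • MonoidAlgebra.of ℂ _ g⁻¹)) := by
  rw [mul_smul_comm, groupInner_smul_left, groupInner_mul_of, mul_smul_comm]
  simp only [groupInner, MonoidAlgebra.coeff_smul, Finsupp.smul_apply, smul_eq_mul, map_mul,
    map_intCast, Finset.mul_sum]
  exact Finset.sum_congr rfl fun _ _ => by ring

theorem groupInner_mul_sum (r : α → ℕ) (f : Equiv.Perm α → ℤ) (hf : ∀ g, f g⁻¹ = f g)
    (x y : MonoidAlgebra ℂ (Equiv.Perm α)) :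
    groupInner (x * ∑ g ∈ fiberPerms r, (f g : ℂ) • MonoidAlgebra.of ℂ _ g) y =
      groupInner x (y * ∑ g ∈ fiberPerms r, (f g : ℂ) • MonoidAlgebra.of ℂ _ g) := by
  rw [Finset.mul_sum, Finset.mul_sum, groupInner_sum_left, groupInner_sum_right]
  refine Finset.sum_equiv (Equiv.inv _) (fun g => ?_) fun g _ => ?_
  · refine ⟨fun h => inv_mem_fiberPerms h, fun h => ?_⟩
    simpa using inv_mem_fiberPerms h
  · rw [groupInner_mul_smul_of, Equiv.inv_apply, hf]

theorem groupInner_mul_colSum (c : α → ℕ) (x y : MonoidAlgebra ℂ (Equiv.Perm α)) :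
    groupInner (x * colSum c) y = groupInner x (y * colSum c) :=
  groupInner_mul_sum c (fun g => (Equiv.Perm.sign g : ℤ)) (fun g => by simp) x y

theorem groupInner_mul_rowSum (r : α → ℕ) (x y : MonoidAlgebra ℂ (Equiv.Perm α)) :
    groupInner (x * rowSum r) y = groupInner x (y * rowSum r) := by
  simpa [rowSum] using groupInner_mul_sum r (fun _ => 1) (fun g => rfl) x y

/-- Right multiplication by the row sum a or the column sum b is self-adjoint, and a², b² are
multiples of a, b. Hence |xaba|² is a multiple of ⟨xabab, xa⟩ = 0, and then |xab|² is a multiple of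
⟨xaba, x⟩ = 0. This replaces the explicit scalar in c² = κc. -/
theorem mul_youngElt_eq_zero {r c : α → ℕ} {x : MonoidAlgebra ℂ (Equiv.Perm α)}
    (h : x * youngElt r c * youngElt r c = 0) : x * youngElt r c = 0 := by
  simp only [youngElt, ← mul_assoc] at h ⊢
  set a := rowSum r with ha
  set b := colSum c with hb
  have h1 : x * a * b * a = 0 := by
    apply eq_zero_of_groupInner_self
    have e1 : groupInner (x * a * b * a) (x * a * b * a) =
        (fiberPerms r).card * groupInner (x * a * b * a) (x * a * b) := by
      rw [← groupInner_mul_rowSum, ← ha, mul_assoc (x * a * b) a a, ha, rowSum_mul_self,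
        mul_smul_comm, groupInner_smul_left]
    rw [e1, ← groupInner_mul_colSum, ← hb, h, groupInner_zero_left, mul_zero]
  apply eq_zero_of_groupInner_self
  rw [← groupInner_mul_colSum, ← hb, mul_assoc (x * a) b b, hb, colSum_mul_self, mul_smul_comm,
    groupInner_smul_left, ← hb, ← groupInner_mul_rowSum, ← ha, h1, groupInner_zero_left, mul_zero]

theorem coeff_colSum (c : α → ℕ) (g : Equiv.Perm α) :
    (colSum c).coeff g = if g ∈ fiberPerms c then ((Equiv.Perm.sign g : ℤ) : ℂ) else 0 := by
  rw [colSum, MonoidAlgebra.coeff_sum, Finset.sum_apply']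
  simp [Finsupp.single_apply, MonoidAlgebra.of_apply]

/-- A permutation that preserves both rows and columns fixes every cell, so 1 = pq forces p = q = 1.
-/
theorem coeff_one_youngElt {r c : α → ℕ} (h : Function.Injective fun a => (r a, c a)) :
    (youngElt r c).coeff 1 = 1 := by
  rw [youngElt, rowSum, Finset.sum_mul, MonoidAlgebra.coeff_sum, Finset.sum_apply',
    Finset.sum_eq_single 1]
  · rw [MonoidHom.map_one, one_mul, coeff_colSum, if_pos (mem_fiberPerms.2 fun _ => rfl)]
    simp
  · intro g hg hne
    rw [MonoidAlgebra.of_apply, MonoidAlgebra.coeff_single_mul_apply, coeff_colSum, if_neg,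
      mul_zero]
    intro hg'
    rw [mul_one] at hg'
    refine hne (Equiv.ext fun a => h ?_)
    have h2 := inv_mem_fiberPerms hg'
    rw [inv_inv] at h2
    simp [mem_fiberPerms.1 hg a, mem_fiberPerms.1 h2 a]
  · exact fun h1 => absurd (mem_fiberPerms.2 fun _ => rfl) h1

theorem youngElt_ne_zero {r c : α → ℕ} (h : Function.Injective fun a => (r a, c a)) :
    youngElt r c ≠ 0 := by
  intro h0
  have := coeff_one_youngElt h
  rw [h0] at this
  simp at this

theorem mapDomain_youngElt (e : α ≃ β) (r c : β → ℕ) :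
    MonoidAlgebra.domCongr ℂ ℂ e.permCongrHom (youngElt (r ∘ e) (c ∘ e)) = youngElt r c := by
  have hmem : ∀ (f : β → ℕ) (g : Equiv.Perm α),
      g ∈ fiberPerms (f ∘ e) ↔ e.permCongrHom g ∈ fiberPerms f := by
    intro f g
    rw [mem_fiberPerms, mem_fiberPerms, ← e.forall_congr_right]
    simp
  rw [youngElt, youngElt, map_mul, rowSum, rowSum, colSum, colSum, map_sum, map_sum]
  congr 1
  · refine Finset.sum_equiv e.permCongrHom.toEquiv (hmem r) fun g _ => ?_
    simp [MonoidAlgebra.of_apply]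
  · refine Finset.sum_equiv e.permCongrHom.toEquiv (hmem c) fun g _ => ?_
    simp [MonoidAlgebra.of_apply]

theorem of_mul_youngElt_comp (σ : Equiv.Perm α) (r c : α → ℕ) :
    MonoidAlgebra.of ℂ _ σ * youngElt (r ∘ σ) (c ∘ σ) = youngElt r c * MonoidAlgebra.of ℂ _ σ := by
  have hmem : ∀ (f : α → ℕ) (g : Equiv.Perm α),
      g ∈ fiberPerms (f ∘ σ) ↔ MulAut.conj σ g ∈ fiberPerms f := by
    intro f g
    rw [mem_fiberPerms, mem_fiberPerms,
      ← σ.forall_congr_right (q := fun a => f (MulAut.conj σ g a) = f a)]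
    simp
  have h1 : MonoidAlgebra.of ℂ _ σ * rowSum (r ∘ σ) = rowSum r * MonoidAlgebra.of ℂ _ σ := by
    rw [rowSum, rowSum, Finset.mul_sum, Finset.sum_mul]
    refine Finset.sum_equiv (MulAut.conj σ).toEquiv (hmem r) fun g _ => ?_
    rw [← map_mul, ← map_mul]
    simp
  have h2 : MonoidAlgebra.of ℂ _ σ * colSum (c ∘ σ) = colSum c * MonoidAlgebra.of ℂ _ σ := by
    rw [colSum, colSum, Finset.mul_sum, Finset.sum_mul]
    refine Finset.sum_equiv (MulAut.conj σ).toEquiv (hmem c) fun g _ => ?_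
    rw [mul_smul_comm, smul_mul_assoc, ← map_mul, ← map_mul]
    simp [mul_right_comm _ _ ((Equiv.Perm.sign σ : ℤ) : ℂ), sign_mul_self]
  rw [youngElt, youngElt, ← mul_assoc, h1, mul_assoc, h2, ← mul_assoc]

/-- The left ideal generated by a Young symmetrizer, as a complex subspace. -/
def youngIdeal (r c : α → ℕ) : Submodule ℂ (MonoidAlgebra ℂ (Equiv.Perm α)) :=
  LinearMap.range (LinearMap.mulRight ℂ (youngElt r c))

theorem finrank_youngIdeal_comp (e : α ≃ β) (r c : β → ℕ) :
    Module.finrank ℂ (youngIdeal (r ∘ e) (c ∘ e)) = Module.finrank ℂ (youngIdeal r c) := by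
  let φ := MonoidAlgebra.domCongr ℂ ℂ e.permCongrHom
  have h : youngIdeal r c = (youngIdeal (r ∘ e) (c ∘ e)).map φ.toLinearEquiv.toLinearMap := by
    rw [youngIdeal, youngIdeal, ← LinearMap.range_comp]
    ext y
    simp only [LinearMap.mem_range, LinearMap.mulRight_apply, LinearMap.comp_apply]
    constructor
    · rintro ⟨x, rfl⟩
      refine ⟨φ.symm x, ?_⟩
      change φ (φ.symm x * _) = _
      rw [map_mul, φ.apply_symm_apply, mapDomain_youngElt]
    · rintro ⟨x, rfl⟩
      refine ⟨φ x, ?_⟩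
      change _ = φ (x * _)
      rw [map_mul, mapDomain_youngElt]
  rw [h]
  exact (φ.toLinearEquiv.submoduleMap _).finrank_eq

end Symmetrizer

theorem dim_eq_finrank_youngIdeal (μ : YoungDiagram) :
    dim μ = Module.finrank ℂ
      (youngIdeal (fun c : μ.cells => c.1.1) (fun c : μ.cells => c.1.2)) := by
  have h : (spechtModule μ).restrictScalars ℂ =
      youngIdeal (fun c : μ.cells => c.1.1) (fun c : μ.cells => c.1.2) := by
    ext x
    rw [Submodule.restrictScalars_mem, spechtModule, Submodule.mem_span_singleton, youngIdeal,
      LinearMap.mem_range]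
    rfl
  rw [← h]
  rfl

/-! ### Triangular families in an algebra -/

section Triangular

variable {A : Type*} [Ring A] [Algebra ℂ A] {ι : Type*} [Fintype ι] [LinearOrder ι]

/-- The left ideals A c_i are independent: in a relation ∑ y_i = 0, right multiplication by c_i for
the least i with y_i ≠ 0 kills all later terms and leaves y_i c_i = 0. -/
theorem sum_finrank_range_mulRight_le [FiniteDimensional ℂ A] (c : ι → A)
    (horth : ∀ i j, i < j → c j * c i = 0)
    (hne : ∀ i x, x * c i * c i = 0 → x * c i = 0) :
    ∑ i, Module.finrank ℂ (LinearMap.range (LinearMap.mulRight ℂ (c i))) ≤ Module.finrank ℂ A := by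
  let Φ : (∀ i, LinearMap.range (LinearMap.mulRight ℂ (c i))) →ₗ[ℂ] A :=
    ∑ i, (LinearMap.range (LinearMap.mulRight ℂ (c i))).subtype ∘ₗ LinearMap.proj i
  have hΦ : ∀ y, Φ y = ∑ i, (y i : A) := fun y => by simp [Φ]
  classical
  rw [← Module.finrank_pi_fintype]
  refine LinearMap.finrank_le_finrank_of_injective (f := Φ) ?_
  rw [injective_iff_map_eq_zero]
  intro y hy
  rw [hΦ] at hy
  by_contra hne0
  have hs : (Finset.univ.filter fun i => y i ≠ 0).Nonempty := by
    obtain ⟨i, hi⟩ := Function.ne_iff.1 hne0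
    exact ⟨i, by simpa using hi⟩
  obtain ⟨i, hi, hmin⟩ := Finset.exists_min_image _ id hs
  simp only [Finset.mem_filter, Finset.mem_univ, true_and, id] at hi hmin
  have h1 := congrArg (· * c i) hy
  simp only [Finset.sum_mul, zero_mul] at h1
  rw [Finset.sum_eq_single i] at h1
  · obtain ⟨x, hx⟩ := (y i).2
    rw [LinearMap.mulRight_apply] at hx
    rw [← hx] at h1
    exact hi (Subtype.ext (by rw [← hx]; exact hne i x h1))
  · intro j _ hji
    by_cases hj : y j = 0
    · simp [hj]
    · obtain ⟨x, hx⟩ := (y j).2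
      rw [← hx, LinearMap.mulRight_apply, mul_assoc,
        horth i j (lt_of_le_of_ne (hmin j hj) hji.symm), mul_zero]
  · exact fun h => absurd (Finset.mem_univ i) h

/-- The mirror argument: left multiplication by c_i for the largest i with nonzero coefficient kills
all earlier terms. -/
theorem linearIndependent_mul_of_triangular (c : ι → A) (u : ι → Aˣ)
    (horth : ∀ i j, i < j → c j * c i = 0) (hne : ∀ i, c i * c i ≠ 0) :
    LinearIndependent ℂ fun i => c i * u i := by
  rw [Fintype.linearIndependent_iff]
  intro a ha
  by_contra! hex
  have hs : (Finset.univ.filter fun i => a i ≠ 0).Nonempty := by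
    obtain ⟨i, hi⟩ := hex
    exact ⟨i, by simpa using hi⟩
  obtain ⟨i, hi, hmax⟩ := Finset.exists_max_image _ id hs
  simp only [Finset.mem_filter, Finset.mem_univ, true_and, id] at hi hmax
  have h1 := congrArg (c i * ·) ha
  simp only [Finset.mul_sum, mul_zero] at h1
  rw [Finset.sum_eq_single i] at h1
  · rw [mul_smul_comm, smul_eq_zero, ← mul_assoc, Units.mul_left_eq_zero] at h1
    exact h1.elim hi (hne i)
  · intro j _ hji
    by_cases hj : a j = 0
    · simp [hj]
    · rw [mul_smul_comm, ← mul_assoc, horth j i (lt_of_le_of_ne (hmax j hj) hji), zero_mul,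
        smul_zero]
  · exact fun h => absurd (Finset.mem_univ i) h

end Triangular

/-! ### Standard tableaux -/

/-- `t k` is the cell of the entry `k`; each initial segment of the entries fills a diagram. -/
def IsStandard {n : ℕ} (t : Fin n → ℕ × ℕ) : Prop :=
  Function.Injective t ∧ ∀ k c, c ≤ t k → ∃ l ≤ k, t l = c

open Classical in
/-- The standard tableaux with `n` entries in the diagram `μ`. -/
def standardTableaux (n : ℕ) (μ : YoungDiagram) : Finset (Fin n → ℕ × ℕ) :=
  (Fintype.piFinset fun _ => μ.cells).filter IsStandard

theorem mem_standardTableaux {n : ℕ} {μ : YoungDiagram} {t : Fin n → ℕ × ℕ} :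
    t ∈ standardTableaux n μ ↔ (∀ k, t k ∈ μ.cells) ∧ IsStandard t := by
  simp [standardTableaux, Fintype.mem_piFinset]

/-- The Young symmetrizer of a tableau. -/
def tableauElt {n : ℕ} (t : Fin n → ℕ × ℕ) : MonoidAlgebra ℂ (Equiv.Perm (Fin n)) :=
  youngElt (fun k => (t k).1) fun k => (t k).2

/-- The left ideal of a tableau. -/
abbrev tableauIdeal {n : ℕ} (t : Fin n → ℕ × ℕ) :
    Submodule ℂ (MonoidAlgebra ℂ (Equiv.Perm (Fin n))) :=
  youngIdeal (fun k => (t k).1) fun k => (t k).2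

/-- The reading order of tableaux. -/
def tableauKey {n : ℕ} (t : Fin n → ℕ × ℕ) : Lex (Fin n → ℕ ×ₗ ℕ) := toLex fun k => toLex (t k)

theorem tableauKey_injective {n : ℕ} : Function.Injective (tableauKey (n := n)) := by
  intro t t' h
  funext k
  exact toLex.injective (congrFun (toLex.injective h) k)

/-- At the first entry k placed differently, t' puts k strictly below and strictly to the left of
its place in t. The cell in the row of t k and the column of t' k then holds one earlier entry l in
both tableaux, so k and l share a row of t and a column of t'. The shapes need not agree. -/
theorem tableauElt_mul_eq_zero {n : ℕ} {t t' : Fin n → ℕ × ℕ} (ht : IsStandard t)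
    (ht' : IsStandard t') (h : tableauKey t < tableauKey t') :
    tableauElt t' * tableauElt t = 0 := by
  obtain ⟨k, hlt, hk⟩ := h
  have hlt' : ∀ l, l < k → t l = t' l := fun l hl => toLex.injective (hlt l hl)
  have hk' : toLex (t k) < toLex (t' k) := hk
  have hne : t k ≠ t' k := fun h => by rw [h] at hk'; exact lt_irrefl _ hk'
  have key : ∀ c, c ≤ t' k → c ≠ t' k → ∃ l < k, t l = c ∧ t' l = c := by
    intro c hc hcne
    obtain ⟨l, hl, rfl⟩ := ht'.2 k c hc
    have hlk : l < k := lt_of_le_of_ne hl fun h => hcne (by rw [h])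
    exact ⟨l, hlk, hlt' l hlk, rfl⟩
  -- Otherwise the cell of k in t would already hold an earlier entry.
  have hnle : ¬ t k ≤ t' k := fun hle => by
    obtain ⟨l, hl, h1, -⟩ := key _ hle hne
    exact hl.ne (ht.1 h1)
  have hrow : (t k).1 ≤ (t' k).1 := by
    rcases Prod.Lex.toLex_lt_toLex.1 hk' with h | h
    · exact h.le
    · exact h.1.le
  have hcol : (t' k).2 < (t k).2 := by
    by_contra! hge
    exact hnle ⟨hrow, hge⟩
  have hrow' : (t k).1 ≠ (t' k).1 := by
    rcases Prod.Lex.toLex_lt_toLex.1 hk' with h | h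
    · exact h.ne
    · exact absurd h.2 (by omega)
  obtain ⟨l, hl, h1, h2⟩ := key ((t k).1, (t' k).2) ⟨hrow, le_rfl⟩ fun h => by
    have h0 := congrArg Prod.fst h
    exact hrow' h0
  exact youngElt_mul_youngElt_eq_zero hl.ne (by rw [h2]) (by rw [h1])

/-- The cells of a tableau, as a bijection. -/
def tableauEquiv {n : ℕ} {μ : YoungDiagram} {t : Fin n → ℕ × ℕ} (hn : μ.card = n)
    (ht : t ∈ standardTableaux n μ) : Fin n ≃ μ.cells :=
  Equiv.ofBijective (fun k => ⟨t k, (mem_standardTableaux.1 ht).1 k⟩) <| by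
    rw [Fintype.bijective_iff_injective_and_card]
    refine ⟨fun k l h => (mem_standardTableaux.1 ht).2.1 (congrArg Subtype.val h), ?_⟩
    rw [Fintype.card_fin, Fintype.card_coe, ← hn]

theorem coe_tableauEquiv {n : ℕ} {μ : YoungDiagram} {t : Fin n → ℕ × ℕ} (hn : μ.card = n)
    (ht : t ∈ standardTableaux n μ) (k : Fin n) : (tableauEquiv hn ht k : ℕ × ℕ) = t k := rfl

theorem finrank_tableauIdeal {n : ℕ} {μ : YoungDiagram} {t : Fin n → ℕ × ℕ} (hn : μ.card = n)
    (ht : t ∈ standardTableaux n μ) : Module.finrank ℂ (tableauIdeal t) = dim μ := by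
  rw [dim_eq_finrank_youngIdeal, ← finrank_youngIdeal_comp (tableauEquiv hn ht)]
  rfl

theorem eq_of_mem_standardTableaux {n : ℕ} {μ ν : YoungDiagram} {t : Fin n → ℕ × ℕ}
    (hμ : μ.card = n) (hν : ν.card = n) (h : t ∈ standardTableaux n μ)
    (h' : t ∈ standardTableaux n ν) : μ = ν := by
  ext c
  constructor
  · intro hc
    obtain ⟨k, hk⟩ := (tableauEquiv hμ h).surjective ⟨c, hc⟩
    rw [← show t k = c from congrArg Subtype.val hk]
    exact (mem_standardTableaux.1 h').1 k
  · intro hc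
    obtain ⟨k, hk⟩ := (tableauEquiv hν h').surjective ⟨c, hc⟩
    rw [← show t k = c from congrArg Subtype.val hk]
    exact (mem_standardTableaux.1 h).1 k

theorem finrank_groupAlgebra (n : ℕ) :
    Module.finrank ℂ (MonoidAlgebra ℂ (Equiv.Perm (Fin n))) = n.factorial := by
  rw [(MonoidAlgebra.coeffLinearEquiv (M := Equiv.Perm (Fin n)) (S := ℂ) ℂ).finrank_eq,
    Module.finrank_finsupp_self, Fintype.card_perm, Fintype.card_fin]

instance (n : ℕ) : FiniteDimensional ℂ (MonoidAlgebra ℂ (Equiv.Perm (Fin n))) :=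
  Module.Finite.equiv (MonoidAlgebra.coeffLinearEquiv (M := Equiv.Perm (Fin n)) (S := ℂ) ℂ).symm

/-- The ideals of all standard tableaux, of all shapes together, are independent in a group algebra
of dimension n!. -/
theorem sum_card_standardTableaux_mul_dim_le {n : ℕ} (S : Finset YoungDiagram)
    (hS : ∀ μ ∈ S, μ.card = n) :
    ∑ μ ∈ S, (standardTableaux n μ).card * dim μ ≤ n.factorial := by
  classical
  let T := S.biUnion (standardTableaux n)
  have hT : ∀ t ∈ T, IsStandard t := fun t ht => by
    obtain ⟨μ, -, h⟩ := Finset.mem_biUnion.1 ht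
    exact (mem_standardTableaux.1 h).2
  let _ : LinearOrder T := LinearOrder.lift' (fun t : T => tableauKey t.1)
    (tableauKey_injective.comp Subtype.val_injective)
  have h := sum_finrank_range_mulRight_le (fun t : T => tableauElt t.1)
    (fun t t' hlt => tableauElt_mul_eq_zero (hT _ t.2) (hT _ t'.2) hlt)
    fun t x => mul_youngElt_eq_zero
  rw [finrank_groupAlgebra] at h
  refine le_trans (le_of_eq ?_) h
  change _ = ∑ t : T, Module.finrank ℂ (tableauIdeal t.1)
  rw [Finset.univ_eq_attach, Finset.sum_attach T fun t => Module.finrank ℂ (tableauIdeal t),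
    Finset.sum_biUnion]
  · refine Finset.sum_congr rfl fun μ hμ => ?_
    rw [Finset.sum_congr rfl fun t ht => finrank_tableauIdeal (hS μ hμ) ht, Finset.sum_const,
      smul_eq_mul]
  · intro μ hμ ν hν hne
    refine Finset.disjoint_left.2 fun t h1 h2 => hne ?_
    exact eq_of_mem_standardTableaux (hS μ hμ) (hS ν hν) h1 h2

theorem tableauElt_mul_self_ne_zero {n : ℕ} {t : Fin n → ℕ × ℕ} (ht : Function.Injective t) :
    tableauElt t * tableauElt t ≠ 0 := by
  intro h
  refine youngElt_ne_zero (r := fun k => (t k).1) (c := fun k => (t k).2) ht ?_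
  have := mul_youngElt_eq_zero (r := fun k => (t k).1) (c := fun k => (t k).2) (x := 1)
  rw [one_mul] at this
  exact this h

/-- Let σ_t relabel the fixed tableau t₀ into t. Then e_t σ_t⁻¹ = σ_t⁻¹ e_{t₀} lies in the single
ideal of t₀, and triangularity makes these elements independent. -/
theorem card_standardTableaux_le_dim {n : ℕ} {μ : YoungDiagram} (hn : μ.card = n) :
    (standardTableaux n μ).card ≤ dim μ := by
  classical
  rcases (standardTableaux n μ).eq_empty_or_nonempty with h0 | ⟨t₀, ht₀⟩
  · simp [h0]
  rw [← finrank_tableauIdeal hn ht₀]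
  let T := standardTableaux n μ
  let _ : LinearOrder T := LinearOrder.lift' (fun t : T => tableauKey t.1)
    (tableauKey_injective.comp Subtype.val_injective)
  let σ : T → Equiv.Perm (Fin n) := fun t =>
    (tableauEquiv hn t.2).trans (tableauEquiv hn ht₀).symm
  have hσ : ∀ t k, t₀ (σ t k) = t.1 k := fun t k => by
    rw [← coe_tableauEquiv hn ht₀, ← coe_tableauEquiv hn t.2]
    simp [σ]
  have hli := linearIndependent_mul_of_triangular (fun t : T => tableauElt t.1)
    (fun t => Units.map (MonoidAlgebra.of ℂ _) (toUnits (σ t)⁻¹))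
    (fun t t' hlt => tableauElt_mul_eq_zero (mem_standardTableaux.1 t.2).2
      (mem_standardTableaux.1 t'.2).2 hlt)
    fun t => tableauElt_mul_self_ne_zero (mem_standardTableaux.1 t.2).2.1
  have hmem : ∀ t : T, tableauElt t.1 * (Units.map (MonoidAlgebra.of ℂ _) (toUnits (σ t)⁻¹) :
      (MonoidAlgebra ℂ (Equiv.Perm (Fin n)))ˣ) ∈ tableauIdeal t₀ := by
    intro t
    refine ⟨MonoidAlgebra.of ℂ _ (σ t)⁻¹, ?_⟩
    have h := of_mul_youngElt_comp (σ t) (fun k => (t₀ k).1) fun k => (t₀ k).2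
    have e1 : ((fun k => (t₀ k).1) ∘ σ t) = fun k => (t.1 k).1 := funext fun k => by
      simp only [Function.comp_apply, hσ]
    have e2 : ((fun k => (t₀ k).2) ∘ σ t) = fun k => (t.1 k).2 := funext fun k => by
      simp only [Function.comp_apply, hσ]
    rw [e1, e2] at h
    have h1 : MonoidAlgebra.of ℂ _ (σ t)⁻¹ * (MonoidAlgebra.of ℂ _ (σ t) * tableauElt t.1) *
        MonoidAlgebra.of ℂ _ (σ t)⁻¹ = MonoidAlgebra.of ℂ _ (σ t)⁻¹ *
          (tableauElt t₀ * MonoidAlgebra.of ℂ _ (σ t)) * MonoidAlgebra.of ℂ _ (σ t)⁻¹ := by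
      rw [tableauElt, h]
      rfl
    rw [← mul_assoc, ← map_mul, inv_mul_cancel, MonoidHom.map_one, one_mul, mul_assoc,
      mul_assoc (tableauElt t₀), ← map_mul, mul_inv_cancel, MonoidHom.map_one, mul_one] at h1
    exact h1.symm
  have hli' : LinearIndependent ℂ fun t : T => (⟨_, hmem t⟩ : tableauIdeal t₀) :=
    LinearIndependent.of_comp (tableauIdeal t₀).subtype hli
  have := hli'.fintype_card_le_finrank
  rwa [Fintype.card_coe] at this

/-! ### Removing a box -/

/-- The diagram without the last box of the row `i`, if this box is a corner. -/
def removeBox (μ : YoungDiagram) (i : ℕ) (h : μ.rowLen (i + 1) < μ.rowLen i) : YoungDiagram where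
  cells := μ.cells.erase (i, μ.rowLen i - 1)
  isLowerSet := by
    rintro ⟨a, b⟩ ⟨a', b'⟩ ⟨ha, hb⟩ hc
    simp only [Finset.coe_erase, Set.mem_sdiff, Set.mem_singleton_iff, Finset.mem_coe,
      YoungDiagram.mem_cells, Prod.mk.injEq, not_and] at hc ha hb ⊢
    refine ⟨μ.up_left_mem ha hb hc.1, ?_⟩
    rintro rfl rfl
    have h1 := YoungDiagram.mem_iff_lt_rowLen.1 hc.1
    rcases ha.eq_or_lt with rfl | hlt
    · exact hc.2 rfl (by omega)
    · have := μ.rowLen_anti (a' + 1) a hlt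
      omega

theorem rowLen_removeBox (μ : YoungDiagram) (i : ℕ) (h : μ.rowLen (i + 1) < μ.rowLen i) (k : ℕ) :
    (removeBox μ i h).rowLen k = if k = i then μ.rowLen i - 1 else μ.rowLen k := by
  refine eq_of_forall_lt_iff fun j => ?_
  rw [← YoungDiagram.mem_iff_lt_rowLen, ← YoungDiagram.mem_cells]
  simp only [removeBox, Finset.mem_erase, YoungDiagram.mem_cells, YoungDiagram.mem_iff_lt_rowLen,
    ne_eq, Prod.mk.injEq, not_and]
  split_ifs with hk
  · subst hk
    simp only [true_imp_iff]
    omega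
  · simp [hk]

theorem last_mem_cells {μ : YoungDiagram} {i : ℕ} (h : μ.rowLen (i + 1) < μ.rowLen i) :
    (i, μ.rowLen i - 1) ∈ μ.cells := by
  rw [YoungDiagram.mem_cells, YoungDiagram.mem_iff_lt_rowLen]
  omega

theorem card_removeBox {μ : YoungDiagram} {i : ℕ} (h : μ.rowLen (i + 1) < μ.rowLen i) :
    (removeBox μ i h).card + 1 = μ.card :=
  Finset.card_erase_add_one (last_mem_cells h)

theorem descents_removeBox {N : ℕ} (μ : YoungDiagram) (i : Fin N)
    (h : μ.rowLen (i + 1) < μ.rowLen i) :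
    descents N (removeBox μ i h) =
      Function.update (descents N μ) i (descents N μ i - 1) := by
  ext k
  by_cases hk : k = i
  · subst hk
    simp only [descents, rowLen_removeBox, if_true, Function.update_self]
    omega
  · simp [descents, rowLen_removeBox, hk, Fin.val_inj]

/-- Shortening a row that has no corner makes two descents equal, or pushes the last one below -N.
-/
theorem factDet_update_eq_zero {N : ℕ} {μ : YoungDiagram} (hμ : μ.rowLen N = 0) (i : Fin N)
    (h : ¬ μ.rowLen (i + 1) < μ.rowLen i) :
    factDet (Function.update (descents N μ) i (descents N μ i - 1)) = 0 := by
  have h1 : μ.rowLen (i + 1) = μ.rowLen i :=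
    le_antisymm (μ.rowLen_anti _ _ (Nat.le_succ _)) (not_lt.1 h)
  by_contra hne
  by_cases hi : (i : ℕ) + 1 < N
  · have h2 := injective_of_factDet_ne_zero hne
    have hne' : (⟨i + 1, hi⟩ : Fin N) ≠ i := fun h => by
      have := congrArg Fin.val h
      simp at this
    refine hne' (h2 ?_)
    rw [Function.update_self, Function.update_of_ne hne']
    simp only [descents, h1]
    push_cast
    ring
  · have h2 := neg_le_of_factDet_ne_zero hne i
    have hi' : (i : ℕ) + 1 = N := by have := i.isLt; omega
    rw [hi', hμ] at h1
    simp only [Function.update_self, descents, ← h1] at h2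
    omega

theorem sum_factDet_removeBox {N : ℕ} {μ : YoungDiagram} (hμ : μ.rowLen N = 0) :
    (μ.card : ℝ) * factDet (descents N μ) = ∑ i : Fin N,
      if h : μ.rowLen (i + 1) < μ.rowLen i then factDet (descents N (removeBox μ i h)) else 0 := by
  have h := sum_factDet_update_sub_one (descents N μ)
  rw [weight_descents hμ, Int.cast_natCast] at h
  rw [← h]
  refine Finset.sum_congr rfl fun i _ => ?_
  split_ifs with hi
  · rw [descents_removeBox]
  · exact factDet_update_eq_zero hμ i hi

theorem snoc_mem_standardTableaux {n : ℕ} {μ : YoungDiagram} {i : ℕ}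
    (h : μ.rowLen (i + 1) < μ.rowLen i) (hn : (removeBox μ i h).card = n) {t : Fin n → ℕ × ℕ}
    (ht : t ∈ standardTableaux n (removeBox μ i h)) :
    (Fin.snoc t (i, μ.rowLen i - 1) : Fin (n + 1) → ℕ × ℕ) ∈ standardTableaux (n + 1) μ := by
  obtain ⟨h1, h2, h3⟩ := mem_standardTableaux.1 ht
  have hne : ∀ k, t k ≠ (i, μ.rowLen i - 1) := fun k => (Finset.mem_erase.1 (h1 k)).1
  refine mem_standardTableaux.2 ⟨fun k => ?_, ?_, fun k c hc => ?_⟩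
  · refine Fin.lastCases ?_ (fun k => ?_) k
    · rw [Fin.snoc_last]
      exact last_mem_cells h
    · rw [Fin.snoc_castSucc]
      exact Finset.mem_of_mem_erase (h1 k)
  · rw [Fin.snoc_injective_iff]
    exact ⟨h2, fun ⟨k, hk⟩ => hne k hk⟩
  · induction k using Fin.lastCases with
    | last =>
      rw [Fin.snoc_last] at hc
      by_cases hc' : c = (i, μ.rowLen i - 1)
      · exact ⟨Fin.last n, le_rfl, by rw [Fin.snoc_last, hc']⟩
      · have hmem : c ∈ (removeBox μ i h).cells :=
          Finset.mem_erase.2 ⟨hc', μ.up_left_mem hc.1 hc.2 (last_mem_cells h)⟩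
        obtain ⟨k, hk⟩ := (tableauEquiv hn ht).surjective ⟨c, hmem⟩
        refine ⟨k.castSucc, Fin.le_last _, ?_⟩
        rw [Fin.snoc_castSucc]
        exact congrArg Subtype.val hk
    | cast k =>
      rw [Fin.snoc_castSucc] at hc
      obtain ⟨l, hl, rfl⟩ := h3 k c hc
      exact ⟨l.castSucc, hl, by rw [Fin.snoc_castSucc]⟩

theorem sum_card_standardTableaux_removeBox_le {n : ℕ} {μ : YoungDiagram} (N : ℕ)
    (hn : μ.card = n + 1) :
    ∑ i : Fin N, (if h : μ.rowLen (i + 1) < μ.rowLen i then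
      (standardTableaux n (removeBox μ i h)).card else 0) ≤ (standardTableaux (n + 1) μ).card := by
  classical
  let T : Fin N → Finset (Fin (n + 1) → ℕ × ℕ) := fun i =>
    if h : μ.rowLen (i + 1) < μ.rowLen i then
      (standardTableaux n (removeBox μ i h)).image fun t => Fin.snoc t (↑i, μ.rowLen i - 1)
    else ∅
  have hT : ∀ i, (T i).card = if h : μ.rowLen (i + 1) < μ.rowLen i then
      (standardTableaux n (removeBox μ i h)).card else 0 := by
    intro i
    simp only [T]
    split_ifs with h
    · refine Finset.card_image_of_injective _ fun t t' htt => ?_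
      exact (Fin.snoc_inj.1 htt).1
    · simp
  simp_rw [← hT]
  rw [← Finset.card_biUnion]
  · refine Finset.card_le_card fun t ht => ?_
    obtain ⟨i, -, hi⟩ := Finset.mem_biUnion.1 ht
    simp only [T] at hi
    split_ifs at hi with h
    · obtain ⟨s, hs, rfl⟩ := Finset.mem_image.1 hi
      refine snoc_mem_standardTableaux h ?_ hs
      have := card_removeBox h
      omega
    · simp at hi
  · intro i _ j _ hij
    refine Finset.disjoint_left.2 fun t hi hj => hij ?_
    simp only [T] at hi hj
    split_ifs at hi hj
    · obtain ⟨s, -, rfl⟩ := Finset.mem_image.1 hi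
      obtain ⟨s', -, h⟩ := Finset.mem_image.1 hj
      exact Fin.ext (congrArg Prod.fst (Fin.snoc_inj.1 h).2).symm
    all_goals simp at hi hj

/-- The determinants satisfy the corner-removal recursion by the lowering identity, and standard
tableaux are bounded below by the same recursion, through the corner that receives the last entry.
One inequality suffices for the squeeze. -/
theorem factDet_pos_and_le (n N : ℕ) : ∀ μ : YoungDiagram, μ.card = n → μ.rowLen N = 0 →
    0 < factDet (descents N μ) ∧
      (n.factorial : ℝ) * factDet (descents N μ) ≤ (standardTableaux n μ).card := by
  induction n with
  | zero =>
    intro μ hn _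
    obtain rfl := card_eq_zero_iff_eq_bot.1 hn
    rw [factDet_descents_bot]
    refine ⟨one_pos, ?_⟩
    have : (Fin.elim0 : Fin 0 → ℕ × ℕ) ∈ standardTableaux 0 ⊥ :=
      mem_standardTableaux.2 ⟨fun k => k.elim0, fun k => k.elim0, fun k => k.elim0⟩
    have := Finset.card_pos.2 ⟨_, this⟩
    simp only [Nat.factorial_zero, Nat.cast_one, mul_one]
    exact_mod_cast this
  | succ n ih =>
    intro μ hn hμ
    have hcard : ∀ i, ∀ h : μ.rowLen (i + 1) < μ.rowLen i, (removeBox μ i h).card = n := by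
      intro i h
      have := card_removeBox h
      omega
    have hrow : ∀ i, ∀ h : μ.rowLen (i + 1) < μ.rowLen i, (removeBox μ i h).rowLen N = 0 := by
      intro i h
      rw [rowLen_removeBox]
      split_ifs with hi
      · rw [← hi, hμ]
      · exact hμ
    have hsum := sum_factDet_removeBox hμ
    rw [hn] at hsum
    constructor
    · have hpos : 0 < ((n + 1 : ℕ) : ℝ) * factDet (descents N μ) := by
        rw [hsum]
        refine Finset.sum_pos' (fun i _ => ?_) ?_
        · split_ifs with h
          · exact (ih _ (hcard i h) (hrow i h)).1.le
          · exact le_rfl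
        -- Without a positive term there is no corner, and emptiness propagates from row N up to the
        -- first row.
        · by_contra! hno
          have hconst : ∀ i ≤ N, μ.rowLen (N - i) = 0 := by
            intro i
            induction i with
            | zero => exact fun _ => hμ
            | succ i ihi =>
              intro hi
              by_contra hne
              have h := hno ⟨N - (i + 1), by omega⟩ (Finset.mem_univ _)
              have hlt : μ.rowLen (N - (i + 1) + 1) < μ.rowLen (N - (i + 1)) := by
                rw [show N - (i + 1) + 1 = N - i by omega, ihi (by omega)]
                omega
              rw [dif_pos hlt] at h
              exact absurd (ih _ (hcard _ hlt) (hrow _ hlt)).1 (not_lt.2 h)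
          have h0 := sum_rowLen μ (N := 0) (by simpa using hconst N le_rfl)
          simp only [Finset.univ_eq_empty, Finset.sum_empty] at h0
          omega
      exact pos_of_mul_pos_right hpos (by positivity)
    · have h1 := sum_card_standardTableaux_removeBox_le N hn
      calc ((n + 1).factorial : ℝ) * factDet (descents N μ)
          = (n.factorial : ℝ) * (((n + 1 : ℕ) : ℝ) * factDet (descents N μ)) := by
            rw [Nat.factorial_succ]; push_cast; ring
        _ ≤ ∑ i : Fin N, ((if h : μ.rowLen (i + 1) < μ.rowLen i then
              (standardTableaux n (removeBox μ i h)).card else 0 : ℕ) : ℝ) := by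
            rw [hsum, Finset.mul_sum]
            refine Finset.sum_le_sum fun i _ => ?_
            split_ifs with h
            · exact (ih _ (hcard i h) (hrow i h)).2
            · simp
        _ ≤ _ := by exact_mod_cast h1

/-! ### The dimension formula -/

theorem finite_card_eq (n : ℕ) : {μ : YoungDiagram | μ.card = n}.Finite := by
  refine Set.Finite.of_injOn (f := fun μ : YoungDiagram => μ.cells)
    (t := ↑(Finset.range n ×ˢ Finset.range n).powerset) ?_ ?_ (Finset.finite_toSet _)
  · rintro μ rfl
    rw [Finset.mem_coe, Finset.mem_powerset]
    rintro ⟨i, j⟩ h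
    rw [YoungDiagram.mem_cells, YoungDiagram.mem_iff_lt_rowLen] at h
    rw [Finset.mem_product, Finset.mem_range, Finset.mem_range]
    constructor
    · by_contra! hi
      rw [rowLen_eq_zero_of_card_le hi] at h
      omega
    · refine h.trans_le ?_
      rw [YoungDiagram.rowLen_eq_card]
      exact Finset.card_le_card (Finset.filter_subset _ _)
  · intro μ _ ν _ h
    exact YoungDiagram.ext h

theorem sum_factDet_sq (n : ℕ) :
    ∑ μ ∈ (finite_card_eq n).toFinset, factDet (descents n μ) ^ 2 = 1 / (n.factorial : ℝ) := by
  classical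
  have h := hasSum_factDet_sq (le_refl n)
  have h' : HasSum (fun μ : YoungDiagram => if μ.card = n then factDet (descents n μ) ^ 2 else 0)
      (1 / (n.factorial : ℝ)) := by
    refine (Subtype.val_injective.hasSum_iff fun μ hμ => ?_).1 h
    rw [if_neg]
    exact fun hc => hμ ⟨⟨μ, rowLen_eq_zero_of_card_le hc.le⟩, rfl⟩
  refine HasSum.unique ?_ h'
  rw [Finset.sum_congr rfl (g := fun μ : YoungDiagram =>
    if μ.card = n then factDet (descents n μ) ^ 2 else 0)]
  · refine hasSum_sum_of_ne_finset_zero fun μ hμ => ?_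
    rw [if_neg]
    simpa using hμ
  · intro μ hμ
    rw [if_pos]
    simpa using hμ

/-- Summed over diagrams of size n: n! = ∑ f² ≤ ∑ f · dim ≤ ∑ s · dim ≤ n!. Equality therefore holds
in every term f² ≤ f · dim, and f > 0 cancels. -/
theorem dim_eq_factorial_mul_factDet {μ : YoungDiagram} {N : ℕ} (hμ : μ.rowLen N = 0) :
    (dim μ : ℝ) = (μ.card.factorial : ℝ) * factDet (descents N μ) := by
  obtain ⟨n, hn⟩ : ∃ n, μ.card = n := ⟨_, rfl⟩
  have hn0 : (0 : ℝ) < n.factorial := by positivity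
  have hrow : ∀ ν : YoungDiagram, ν.card = n → ν.rowLen n = 0 := fun ν h =>
    rowLen_eq_zero_of_card_le h.le
  have hdet : factDet (descents N μ) = factDet (descents n μ) := by
    rcases le_total N n with h | h
    · exact (factDet_descents_of_le hμ h).symm
    · exact factDet_descents_of_le (hrow μ hn) h
  rw [hdet, hn]
  set S := (finite_card_eq n).toFinset with hS
  have hmem : ∀ {ν}, ν ∈ S ↔ ν.card = n := fun {ν} => by simp [hS]
  let f : YoungDiagram → ℝ := fun ν => n.factorial * factDet (descents n ν)
  have hf : ∀ ν ∈ S, 0 < f ν ∧ f ν ≤ (standardTableaux n ν).card := fun ν hν => by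
    have h := factDet_pos_and_le n n ν (hmem.1 hν) (hrow ν (hmem.1 hν))
    exact ⟨mul_pos hn0 h.1, h.2⟩
  have hd : ∀ ν ∈ S, ((standardTableaux n ν).card : ℝ) ≤ dim ν := fun ν hν => by
    exact_mod_cast card_standardTableaux_le_dim (hmem.1 hν)
  have h1 : ∑ ν ∈ S, f ν ^ 2 = n.factorial := by
    simp only [f, mul_pow, ← Finset.mul_sum]
    rw [hS, sum_factDet_sq]
    field_simp
  have h2 : ∑ ν ∈ S, ((standardTableaux n ν).card : ℝ) * dim ν ≤ n.factorial := by
    exact_mod_cast sum_card_standardTableaux_mul_dim_le S fun ν hν => hmem.1 hν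
  have hle : ∀ ν ∈ S, f ν ^ 2 ≤ f ν * dim ν := fun ν hν => by
    rw [sq]
    exact mul_le_mul_of_nonneg_left ((hf ν hν).2.trans (hd ν hν)) (hf ν hν).1.le
  have h3 : ∑ ν ∈ S, f ν * dim ν ≤ ∑ ν ∈ S, f ν ^ 2 := by
    rw [h1]
    refine le_trans (Finset.sum_le_sum fun ν hν => ?_) h2
    exact mul_le_mul_of_nonneg_right (hf ν hν).2 (Nat.cast_nonneg _)
  have h4 := (Finset.sum_eq_sum_iff_of_le hle).1 (le_antisymm (Finset.sum_le_sum hle) h3)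
  have h5 := h4 μ (hmem.2 hn)
  rw [sq] at h5
  exact (mul_left_cancel₀ (hf μ (hmem.2 hn)).1.ne' h5).symm

/-! ### Bessel functions of real order -/

/-- The complex function 1/Γ is entire; the convention 1/0 = 0 gives its correct zeros at the poles
of Γ. -/
theorem continuous_inv_Gamma : Continuous fun s : ℝ => (Real.Gamma s)⁻¹ := by
  have h : (fun s : ℝ => (Real.Gamma s)⁻¹) = fun s : ℝ => ((Complex.Gamma (s : ℂ))⁻¹).re := by
    ext s
    rw [Complex.Gamma_ofReal, ← Complex.ofReal_inv, Complex.ofReal_re]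
  rw [h]
  exact Complex.continuous_re.comp
    (Complex.differentiable_one_div_Gamma.continuous.comp Complex.continuous_ofReal)

theorem inv_Gamma_nonneg_of_two_le {s : ℝ} (hs : 2 ≤ s) : 0 ≤ (Real.Gamma s)⁻¹ :=
  inv_nonneg.2 (Real.Gamma_pos_of_pos (by linarith)).le

theorem inv_Gamma_anti {s s' : ℝ} (hs : 2 ≤ s) (h : s ≤ s') :
    (Real.Gamma s')⁻¹ ≤ (Real.Gamma s)⁻¹ := by
  have := Real.Gamma_strictMonoOn_Ici.monotoneOn (Set.mem_Ici.2 hs) (Set.mem_Ici.2 (hs.trans h)) h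
  exact inv_anti₀ (Real.Gamma_pos_of_pos (by linarith)) this

theorem inv_Gamma_le_one {s : ℝ} (hs : 2 ≤ s) : (Real.Gamma s)⁻¹ ≤ 1 := by
  simpa [Real.Gamma_two] using inv_Gamma_anti le_rfl hs

theorem exists_bound_inv_Gamma (a : ℝ) : ∃ C, ∀ s, a ≤ s → |(Real.Gamma s)⁻¹| ≤ C := by
  obtain ⟨C, hC⟩ := (isCompact_Icc (a := a) (b := 2)).exists_bound_of_continuousOn
    continuous_inv_Gamma.continuousOn
  refine ⟨max C 1, fun s hs => ?_⟩
  rcases le_total s 2 with h | h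
  · exact (hC s ⟨hs, h⟩).trans (le_max_left _ _)
  · rw [abs_of_nonneg (inv_Gamma_nonneg_of_two_le h)]
    exact (inv_Gamma_le_one h).trans (le_max_right _ _)

/-- The terms of the Bessel series at the argument `2t`. -/
def besselTerm (t ν : ℝ) (m : ℕ) : ℝ :=
  (-1) ^ m / (m.factorial : ℝ) * (Real.Gamma (ν + m + 1))⁻¹ * (t ^ (2 * m) * t ^ ν)

theorem besselJ_eq_tsum {t : ℝ} (ht : 0 < t) (ν : ℝ) :
    besselJ ν (2 * t) = ∑' m, besselTerm t ν m := by
  refine tsum_congr fun m => ?_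
  rw [besselTerm, mul_div_cancel_left₀ t two_ne_zero, Real.rpow_add ht,
    ← Real.rpow_natCast t (2 * m)]
  push_cast
  rw [div_mul_eq_div_div]
  ring

theorem abs_besselTerm_le {t ν C : ℝ} (ht : 0 < t) {m : ℕ}
    (hC : |(Real.Gamma (ν + m + 1))⁻¹| ≤ C) :
    |besselTerm t ν m| ≤ C * t ^ ν * ((t ^ 2) ^ m / (m.factorial : ℝ)) := by
  have h1 : 0 < t ^ ν := Real.rpow_pos_of_pos ht ν
  rw [besselTerm, abs_mul, abs_mul, abs_div, abs_pow, abs_neg, abs_one, one_pow, Nat.abs_cast,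
    abs_of_pos (by positivity : 0 < t ^ (2 * m) * t ^ ν), ← pow_mul]
  calc _ ≤ 1 / (m.factorial : ℝ) * C * (t ^ (2 * m) * t ^ ν) := by gcongr
    _ = _ := by ring

theorem summable_besselTerm {t : ℝ} (ht : 0 < t) (ν : ℝ) : Summable (besselTerm t ν) := by
  obtain ⟨C, hC⟩ := exists_bound_inv_Gamma (ν + 1)
  refine Summable.of_norm_bounded ((Real.summable_pow_div_factorial (t ^ 2)).mul_left (C * t ^ ν))
    fun m => abs_besselTerm_le ht (hC _ ?_)
  have : (0 : ℝ) ≤ m := Nat.cast_nonneg m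
  linarith

theorem continuousOn_besselJ {t : ℝ} (ht : 0 < t) (a b : ℝ) :
    ContinuousOn (fun ν => besselJ ν (2 * t)) (Set.Icc a b) := by
  have hpow : Continuous fun ν : ℝ => t ^ ν := Real.continuous_const_rpow ht.ne'
  obtain ⟨B, hB⟩ := (isCompact_Icc (a := a) (b := b)).exists_bound_of_continuousOn
    hpow.continuousOn
  obtain ⟨C, hC⟩ := exists_bound_inv_Gamma (a + 1)
  simp_rw [besselJ_eq_tsum ht]
  refine continuousOn_tsum (u := fun m => C * B * ((t ^ 2) ^ m / (m.factorial : ℝ))) (fun m => ?_)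
    ((Real.summable_pow_div_factorial (t ^ 2)).mul_left (C * B)) fun m ν hν => ?_
  · refine Continuous.continuousOn ?_
    unfold besselTerm
    exact (continuous_const.mul (continuous_inv_Gamma.comp (by fun_prop))).mul
      (continuous_const.mul hpow)
  · have hm : (0 : ℝ) ≤ m := Nat.cast_nonneg m
    have hCν : |(Real.Gamma (ν + m + 1))⁻¹| ≤ C := hC _ (by linarith [hν.1])
    refine (abs_besselTerm_le ht hCν).trans ?_
    have hC0 : 0 ≤ C := (abs_nonneg _).trans hCν
    have := (le_abs_self _).trans (hB ν hν)
    gcongr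

theorem continuous_besselJ {t : ℝ} (ht : 0 < t) : Continuous fun ν => besselJ ν (2 * t) :=
  continuous_iff_continuousAt.2 fun ν => (continuousOn_besselJ ht (ν - 1) (ν + 1)).continuousAt
    (Icc_mem_nhds (by linarith) (by linarith))

/-- After an index shift, t J_{ν+1} has the terms -m times those of J_ν, and t J_{ν-1} has the terms
ν + m times those of J_ν. -/
theorem besselJ_recurrence {t : ℝ} (ht : 0 < t) (ν : ℝ) :
    t * besselJ (ν - 1) (2 * t) + t * besselJ (ν + 1) (2 * t) = ν * besselJ ν (2 * t) := by
  simp only [besselJ_eq_tsum ht]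
  have h1 : HasSum (fun m => t * besselTerm t (ν - 1) m) (t * ∑' m, besselTerm t (ν - 1) m) :=
    (summable_besselTerm ht _).hasSum.mul_left t
  have h2 : HasSum (fun m : ℕ => -((m : ℝ) * besselTerm t ν m))
      (t * ∑' m, besselTerm t (ν + 1) m) := by
    rw [← hasSum_nat_add_iff' 1]
    simp only [Finset.range_one, Finset.sum_singleton, Nat.cast_zero, zero_mul, neg_zero, sub_zero]
    convert! (summable_besselTerm ht (ν + 1)).hasSum.mul_left t using 1
    ext m
    simp only [besselTerm]
    rw [Nat.factorial_succ, Real.rpow_add ht, Real.rpow_one,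
      show ν + ((m + 1 : ℕ) : ℝ) + 1 = ν + 1 + m + 1 by push_cast; ring]
    have : ((m : ℝ) + 1) ≠ 0 := by positivity
    push_cast
    field_simp
    ring
  have h3 := (h1.add h2).unique (a₂ := ν * ∑' m, besselTerm t ν m) ?_
  · exact h3
  · convert! (summable_besselTerm ht ν).hasSum.mul_left ν using 1
    ext m
    simp only [besselTerm]
    rw [Real.rpow_sub ht, Real.rpow_one, show ν - 1 + (m : ℝ) + 1 = ν + m by ring,
      ← self_mul_inv_Gamma_add_one]
    field_simp
    ring

theorem abs_besselJ_le {t ν : ℝ} (ht : 0 < t) (hν : 1 ≤ ν) :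
    |besselJ ν (2 * t)| ≤ (Real.Gamma (ν + 1))⁻¹ * t ^ ν * Real.exp (t ^ 2) := by
  rw [besselJ_eq_tsum ht]
  have h : HasSum (fun m : ℕ => (Real.Gamma (ν + 1))⁻¹ * t ^ ν * ((t ^ 2) ^ m / (m.factorial : ℝ)))
      ((Real.Gamma (ν + 1))⁻¹ * t ^ ν * Real.exp (t ^ 2)) := by
    rw [Real.exp_eq_exp_ℝ]
    exact (NormedSpace.expSeries_div_hasSum_exp (t ^ 2)).mul_left _
  refine tsum_of_norm_bounded (f := besselTerm t ν) h fun m => abs_besselTerm_le ht ?_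
  have hm : (0 : ℝ) ≤ m := Nat.cast_nonneg m
  rw [abs_of_nonneg (inv_Gamma_nonneg_of_two_le (by linarith))]
  exact inv_Gamma_anti (by linarith) (by linarith)

theorem abs_besselJ_mul_le {t u v : ℝ} (ht : 0 < t) (hu : 1 ≤ u) (hv : 1 ≤ v) (j : ℕ) :
    |besselJ (u + j) (2 * t) * besselJ (v + j) (2 * t)| ≤
      t ^ u * t ^ v * Real.exp (t ^ 2) ^ 2 * ((t ^ 2) ^ j / (j.factorial : ℝ)) := by
  have hj : (0 : ℝ) ≤ j := Nat.cast_nonneg j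
  have h1 := abs_besselJ_le ht (show 1 ≤ u + j by linarith)
  have h2 := abs_besselJ_le ht (show 1 ≤ v + j by linarith)
  have h3 : (Real.Gamma (u + j + 1))⁻¹ ≤ 1 / (j.factorial : ℝ) := by
    refine (inv_Gamma_anti (s := (j + 1 : ℕ) + 1) (by push_cast; linarith)
      (by push_cast; linarith)).trans ?_
    rw [Real.Gamma_nat_eq_factorial, ← one_div]
    exact one_div_le_one_div_of_le (by positivity)
      (by exact_mod_cast Nat.factorial_le (Nat.le_succ j))
  have h4 : (Real.Gamma (v + j + 1))⁻¹ ≤ 1 := inv_Gamma_le_one (by linarith)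
  have hpu := Real.rpow_pos_of_pos ht u
  have hpv := Real.rpow_pos_of_pos ht v
  rw [abs_mul]
  calc _ ≤ ((Real.Gamma (u + j + 1))⁻¹ * t ^ (u + j) * Real.exp (t ^ 2)) *
        ((Real.Gamma (v + j + 1))⁻¹ * t ^ (v + j) * Real.exp (t ^ 2)) :=
        mul_le_mul h1 h2 (abs_nonneg _) ((abs_nonneg _).trans h1)
    _ ≤ (1 / (j.factorial : ℝ) * t ^ (u + j) * Real.exp (t ^ 2)) *
        (1 * t ^ (v + j) * Real.exp (t ^ 2)) := by
        have := inv_Gamma_nonneg_of_two_le (show 2 ≤ v + j + 1 by linarith)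
        have := Real.rpow_pos_of_pos ht (u + j)
        have := Real.rpow_pos_of_pos ht (v + j)
        gcongr
    _ = _ := by
        rw [Real.rpow_add ht, Real.rpow_add ht, Real.rpow_natCast]
        ring

theorem summable_besselJ_mul {t : ℝ} (ht : 0 < t) (u v : ℝ) :
    Summable fun j : ℕ => besselJ (u + j) (2 * t) * besselJ (v + j) (2 * t) := by
  obtain ⟨m, hm⟩ := exists_nat_ge (max (1 - u) (1 - v))
  have hu := (le_max_left _ _).trans hm
  have hv := (le_max_right _ _).trans hm
  rw [← summable_nat_add_iff m]
  refine Summable.of_norm_bounded ((Real.summable_pow_div_factorial (t ^ 2)).mul_left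
    (t ^ (u + m) * t ^ (v + m) * Real.exp (t ^ 2) ^ 2)) fun j => ?_
  have h := abs_besselJ_mul_le ht (show 1 ≤ u + m by linarith) (show 1 ≤ v + m by linarith) j
  convert! h using 2
  push_cast
  ring_nf

/-- The three-term recurrence at u + 1 and v + 1, cross-multiplied and subtracted, produces the
factor u - v that cancels the denominator. -/
theorem kernelQuotient_sub {θ : ℝ} (hθ : 0 < θ) {u v : ℝ} (huv : u ≠ v) :
    kernelQuotient θ u v - kernelQuotient θ (u + 1) (v + 1) =
      besselJ (u + 1) (2 * √θ) * besselJ (v + 1) (2 * √θ) := by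
  have ht := Real.sqrt_pos.2 hθ
  have h1 := besselJ_recurrence ht (u + 1)
  have h2 := besselJ_recurrence ht (v + 1)
  rw [add_sub_cancel_right] at h1 h2
  have h3 : u - v ≠ 0 := sub_ne_zero.2 huv
  simp only [kernelQuotient, add_sub_add_right_eq_sub]
  generalize 2 * √θ = z at h1 h2 ⊢
  field_simp
  linear_combination besselJ (v + 1) z * h1 - besselJ (u + 1) z * h2

theorem hasSum_kernelQuotient {θ : ℝ} (hθ : 0 < θ) {u v : ℝ} (huv : u ≠ v) :
    HasSum (fun j : ℕ => besselJ (u + 1 + j) (2 * √θ) * besselJ (v + 1 + j) (2 * √θ))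
      (kernelQuotient θ u v) := by
  have ht := Real.sqrt_pos.2 hθ
  have hs := summable_besselJ_mul ht (u + 1) (v + 1)
  have hpart : ∀ n : ℕ, ∑ j ∈ Finset.range n,
      besselJ (u + 1 + j) (2 * √θ) * besselJ (v + 1 + j) (2 * √θ) =
        kernelQuotient θ u v - kernelQuotient θ (u + n) (v + n) := by
    intro n
    induction n with
    | zero => simp
    | succ n ih =>
      have h := kernelQuotient_sub hθ (u := u + n) (v := v + n) (by simpa using huv)
      rw [Finset.sum_range_succ, ih, show u + 1 + (n : ℝ) = u + n + 1 by ring,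
        show v + 1 + (n : ℝ) = v + n + 1 by ring, ← h]
      push_cast
      ring_nf
  -- The denominator stays u - v along the diagonal shift, and the numerator consists of terms of
  -- summable series.
  have hlim : Tendsto (fun n : ℕ => kernelQuotient θ (u + n) (v + n)) atTop (𝓝 0) := by
    have e1 := (summable_besselJ_mul ht u (v + 1)).tendsto_atTop_zero
    have e2 := (summable_besselJ_mul ht (u + 1) v).tendsto_atTop_zero
    have e3 := ((e1.sub e2).div_const (u - v)).const_mul (√θ)
    simp only [sub_zero, zero_div, mul_zero] at e3
    refine e3.congr fun n => ?_
    simp only [kernelQuotient, add_sub_add_right_eq_sub]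
    ring_nf
  refine (hs.hasSum_iff_tendsto_nat).2 ?_
  simp_rw [hpart]
  simpa using tendsto_const_nhds.sub hlim

theorem tendsto_tsum_besselJ_mul {t : ℝ} (ht : 0 < t) (u : ℝ) :
    Tendsto (fun v => ∑' j : ℕ, besselJ (u + 1 + j) (2 * t) * besselJ (v + 1 + j) (2 * t)) (𝓝 u)
      (𝓝 (∑' j : ℕ, besselJ (u + 1 + j) (2 * t) * besselJ (u + 1 + j) (2 * t))) := by
  obtain ⟨m, hm⟩ := exists_nat_ge (1 - u)
  have hcont := continuous_besselJ ht
  have hc : ∀ a : ℝ, Tendsto (fun v => besselJ (v + 1 + a) (2 * t)) (𝓝 u)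
      (𝓝 (besselJ (u + 1 + a) (2 * t))) := fun a =>
    (hcont.comp (by fun_prop : Continuous fun v : ℝ => v + 1 + a)).tendsto u
  have hsplit : ∀ v, ∑' j : ℕ, besselJ (u + 1 + j) (2 * t) * besselJ (v + 1 + j) (2 * t) =
      ∑ j ∈ Finset.range m, besselJ (u + 1 + j) (2 * t) * besselJ (v + 1 + j) (2 * t) +
        ∑' j : ℕ, besselJ (u + 1 + (j + m : ℕ)) (2 * t) * besselJ (v + 1 + (j + m : ℕ)) (2 * t) :=
    fun v => ((summable_besselJ_mul ht (u + 1) (v + 1)).sum_add_tsum_nat_add m).symm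
  simp_rw [hsplit]
  -- The uniform factorial bound needs orders at least 1, so finitely many terms are handled by
  -- continuity and the tail by domination.
  refine Tendsto.add (tendsto_finsetSum _ fun j _ => tendsto_const_nhds.mul (hc j)) ?_
  have hpow : Continuous fun v : ℝ => t ^ (v + 1 + m) :=
    (Real.continuous_const_rpow ht.ne').comp (by fun_prop)
  obtain ⟨B, hB⟩ := (isCompact_Icc (a := u - 1) (b := u + 1)).exists_bound_of_continuousOn
    hpow.continuousOn
  refine tendsto_tsum_of_dominated_convergence
    ((Real.summable_pow_div_factorial (t ^ 2)).mul_left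
      (t ^ (u + 1 + m) * B * Real.exp (t ^ 2) ^ 2))
    (fun j => tendsto_const_nhds.mul (hc _)) ?_
  filter_upwards [Icc_mem_nhds (show u - 1 < u by linarith) (show u < u + 1 by linarith)]
    with v hv j
  have h := abs_besselJ_mul_le ht (show 1 ≤ u + 1 + m by linarith)
    (show 1 ≤ v + 1 + m by linarith [hv.1]) j
  have hBv := (le_abs_self _).trans (hB v hv)
  have hpu := Real.rpow_pos_of_pos ht (u + 1 + m)
  rw [Real.norm_eq_abs, Nat.cast_add, add_comm (j : ℝ) m, ← add_assoc, ← add_assoc]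
  refine h.trans ?_
  gcongr

theorem tendsto_kernelQuotient {θ : ℝ} (hθ : 0 < θ) (u : ℝ) :
    Tendsto (fun v => kernelQuotient θ u v) (𝓝[≠] u)
      (𝓝 (∑' j : ℕ, besselJ (u + 1 + j) (2 * √θ) * besselJ (u + 1 + j) (2 * √θ))) := by
  refine ((tendsto_tsum_besselJ_mul (Real.sqrt_pos.2 hθ) u).mono_left nhdsWithin_le_nhds).congr' ?_
  filter_upwards [self_mem_nhdsWithin] with v hv
  exact (hasSum_kernelQuotient hθ (Ne.symm hv)).tsum_eq

theorem besselKernel_eq_tsum {θ : ℝ} (hθ : 0 < θ) (x y : ℤ) : besselKernel θ x y =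
    ∑' j : ℕ, besselJ (x + 1 + j) (2 * √θ) * besselJ (y + 1 + j) (2 * √θ) := by
  rw [besselKernel]
  split_ifs with h
  · subst h
    exact (tendsto_kernelQuotient hθ x).limUnder_eq
  · exact (hasSum_kernelQuotient hθ (by exact_mod_cast h)).tsum_eq.symm

/-- The divided power `t^k / k!`, extended by zero to the negative integers. -/
def divPow (t : ℝ) (k : ℤ) : ℝ := t ^ k * recipFact k

theorem hasSum_besselJ_int {t : ℝ} (ht : 0 < t) (k : ℤ) :
    HasSum (fun m : ℕ => (-t) ^ m / (m.factorial : ℝ) * divPow t (k + m)) (besselJ k (2 * t)) := by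
  rw [besselJ_eq_tsum ht]
  convert! (summable_besselTerm ht k).hasSum using 1
  ext m
  rw [besselTerm, divPow, recipFact, zpow_add₀ ht.ne', Real.rpow_intCast, zpow_natCast,
    ← neg_one_mul t, mul_pow, two_mul, pow_add]
  push_cast
  ring

/-! ### Projections in the Hilbert space of sequences -/

section Hilbert

variable {E : Type*} [NormedAddCommGroup E] [InnerProductSpace ℝ E]

theorem hasSum_exp_apply [CompleteSpace E] (A : E →L[ℝ] E) (c : ℝ) (w : ℕ → E)
    (hw : ∀ m, (A ^ m) (w 0) = w m) :
    HasSum (fun m : ℕ => (c ^ m / (m.factorial : ℝ)) • w m) (NormedSpace.exp (c • A) (w 0)) := by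
  have h := (ContinuousLinearMap.apply ℝ E (w 0)).hasSum
    (NormedSpace.exp_series_hasSum_exp' (𝕂 := ℝ) (c • A))
  convert! h using 1
  ext m
  simp only [ContinuousLinearMap.apply_apply, smul_apply,
    smul_pow, hw, smul_smul]
  congr 1
  ring

theorem pow_apply_of_forall (A : E →L[ℝ] E) (w : ℕ → E) (hw : ∀ m, A (w m) = w (m + 1)) (m : ℕ) :
    (A ^ m) (w 0) = w m := by
  induction m with
  | zero => simp
  | succ m ih => rw [pow_succ', mul_apply_eq_comp, ih, hw]

theorem orthonormal_shift (e : HilbertBasis ℤ ℝ E) : Orthonormal ℝ fun k => e (k + 1) :=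
  e.orthonormal.comp (fun k : ℤ => k + 1) (add_left_injective 1)

theorem dense_shift (e : HilbertBasis ℤ ℝ E) :
    ⊤ ≤ (Submodule.span ℝ (Set.range fun k => e (k + 1))).topologicalClosure := by
  have : (Set.range fun k => e (k + 1)) = Set.range e :=
    (Equiv.addRight (1 : ℤ)).surjective.range_comp e
  rw [this, e.dense_span]

/-- The span of the first `N` vectors of a sequence. -/
def spanFirst (w : ℕ → E) (N : ℕ) : Submodule ℝ E :=
  Submodule.span ℝ (Set.range fun i : Fin N => w i)

instance (w : ℕ → E) (N : ℕ) : FiniteDimensional ℝ (spanFirst w N) :=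
  FiniteDimensional.span_of_finite ℝ (Set.finite_range _)

theorem mem_spanFirst (w : ℕ → E) {N j : ℕ} (h : j < N) : w j ∈ spanFirst w N :=
  Submodule.subset_span ⟨⟨j, h⟩, rfl⟩

theorem monotone_spanFirst (w : ℕ → E) : Monotone (spanFirst w) := by
  intro N M h
  refine Submodule.span_le.2 ?_
  rintro _ ⟨i, rfl⟩
  exact mem_spanFirst w (i.isLt.trans_le h)

/-- Each w'_j is a series in w_j, w_{j+1}, … only. Applied in both directions, this identifies the
closed spans of the exponential and the Bessel vectors. -/
theorem closure_spanFirst_le {w w' : ℕ → E} {c : ℕ → ℝ}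
    (h : ∀ j, HasSum (fun m => c m • w (j + m)) (w' j)) :
    (⨆ N, spanFirst w' N).topologicalClosure ≤ (⨆ N, spanFirst w N).topologicalClosure := by
  refine Submodule.topologicalClosure_minimal _ (iSup_le fun N => Submodule.span_le.2 ?_)
    (Submodule.isClosed_topologicalClosure _)
  rintro _ ⟨i, rfl⟩
  refine (Submodule.isClosed_topologicalClosure _).mem_of_tendsto (h i)
    (Eventually.of_forall fun s => Submodule.sum_mem _ fun m _ => Submodule.smul_mem _ _ ?_)
  refine Submodule.le_topologicalClosure _ (Submodule.mem_iSup_of_mem (i + m + 1) ?_)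
  exact mem_spanFirst w (Nat.lt_succ_self _)

/-- The Gram matrix of the first `N` vectors of a sequence. -/
def gram (w : ℕ → E) (N : ℕ) : Matrix (Fin N) (Fin N) ℝ :=
  Matrix.of fun i j => inner ℝ (w i) (w j)

theorem inner_starProjection_spanFirst (w : ℕ → E) (N : ℕ) (h : IsUnit (gram w N).det) (a b : E) :
    inner ℝ a ((spanFirst w N).starProjection b) =
      (fun i : Fin N => inner ℝ a (w i)) ⬝ᵥ
        ((gram w N)⁻¹.mulVec fun j : Fin N => inner ℝ (w j) b) := by
  set d := (gram w N)⁻¹.mulVec fun j : Fin N => inner ℝ (w j) b with hd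
  have hproj : (spanFirst w N).starProjection b = ∑ i : Fin N, d i • w i := by
    refine Submodule.eq_starProjection_of_mem_of_inner_eq_zero (K := spanFirst w N) (u := b)
      (v := ∑ i : Fin N, d i • w i) ?_ ?_
    · exact Submodule.sum_mem _ fun i _ => Submodule.smul_mem _ _ (mem_spanFirst w i.isLt)
    · intro z hz
      induction hz using Submodule.span_induction with
      | mem z hz =>
        obtain ⟨j, rfl⟩ := hz
        have h1 : (gram w N).mulVec d j = inner ℝ (w j) b := by
          rw [hd, Matrix.mulVec_mulVec, Matrix.mul_nonsing_inv _ h, Matrix.one_mulVec]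
        rw [inner_sub_left, sum_inner, real_inner_comm, ← h1, Matrix.mulVec, dotProduct]
        rw [sub_eq_zero]
        refine Finset.sum_congr rfl fun i _ => ?_
        rw [real_inner_smul_left, gram, Matrix.of_apply, real_inner_comm, mul_comm]
      | zero => exact inner_zero_right _
      | add x y _ _ hx hy => rw [inner_add_right, hx, hy, add_zero]
      | smul c x _ hx => rw [inner_smul_right, hx, mul_zero]
  rw [hproj, inner_sum, dotProduct]
  exact Finset.sum_congr rfl fun i _ => by rw [inner_smul_right, mul_comm]

/-! ### The bilateral shift and the exponential and Bessel vectors -/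

variable [CompleteSpace E] (e : HilbertBasis ℤ ℝ E)

/-- The bilateral shift `e_k ↦ e_{k+1}`. -/
def shift : E ≃ₗᵢ[ℝ] E :=
  e.repr.trans (HilbertBasis.mk (orthonormal_shift e) (dense_shift e)).repr.symm

theorem shift_apply (k : ℤ) : shift e (e k) = e (k + 1) := by
  rw [shift, LinearIsometryEquiv.trans_apply, HilbertBasis.repr_self, HilbertBasis.repr_symm_single,
    HilbertBasis.coe_mk]

/-- The shift as an operator. -/
def shiftUp : E →L[ℝ] E := ((shift e : E ≃L[ℝ] E) : E →L[ℝ] E)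

/-- The inverse shift as an operator. -/
def shiftDown : E →L[ℝ] E := (((shift e).symm : E ≃L[ℝ] E) : E →L[ℝ] E)

theorem shiftUp_apply (k : ℤ) : shiftUp e (e k) = e (k + 1) := shift_apply e k

theorem shiftDown_apply (k : ℤ) : shiftDown e (e k) = e (k - 1) := by
  change (shift e).symm (e k) = _
  rw [LinearIsometryEquiv.symm_apply_eq, shift_apply, sub_add_cancel]

theorem commute_shift : Commute (shiftUp e) (shiftDown e) := by
  ext x
  exact ((shift e).apply_symm_apply x).trans ((shift e).symm_apply_apply x).symm

theorem star_shiftUp : star (shiftUp e) = shiftDown e :=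
  (shift e).adjoint_eq_symm

theorem star_shiftDown : star (shiftDown e) = shiftUp e := by
  rw [← star_shiftUp, star_star]

/-- The vector with coordinates `t^{x+j} / (x+j)!`. -/
def expVec (t : ℝ) (j : ℤ) : E := NormedSpace.exp (t • shiftUp e) (e (-j))

/-- The vector with coordinates `J_{x+j}(2t)`. -/
def besselVec (t : ℝ) (j : ℤ) : E := NormedSpace.exp (-t • shiftDown e) (expVec e t j)

theorem inner_expVec (t : ℝ) (x j : ℤ) : inner ℝ (e x) (expVec e t j) = divPow t (x + j) := by
  have h := hasSum_exp_apply (shiftUp e) t (fun m => e (-j + m)) fun m =>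
    pow_apply_of_forall (shiftUp e) (fun m : ℕ => e (-j + m))
      (fun m => by rw [shiftUp_apply]; push_cast; ring_nf) m
  simp only [Nat.cast_zero, add_zero] at h
  have h1 := (innerSL ℝ (e x)).hasSum h
  refine h1.unique ?_
  have horth : ∀ m : ℕ, inner ℝ (e x) (e (-j + m)) = if x = -j + m then (1 : ℝ) else 0 :=
    fun m => orthonormal_iff_ite.1 e.orthonormal x _
  simp only [innerSL_apply_apply, inner_smul_right, horth]
  rcases lt_or_ge (x + j) 0 with hneg | hpos
  · rw [divPow, recipFact_of_neg hneg, mul_zero]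
    convert! hasSum_zero (α := ℝ) (β := ℕ) using 2 with m
    rw [if_neg (by omega), mul_zero]
  · obtain ⟨n, hn⟩ := Int.eq_ofNat_of_zero_le hpos
    have h2 := hasSum_single (f := fun m : ℕ => t ^ m / (m.factorial : ℝ) *
      if x = -j + m then (1 : ℝ) else 0) n fun m hm => by
        rw [if_neg (by omega), mul_zero]
    rw [if_pos (by omega), mul_one] at h2
    rw [hn, divPow, recipFact_natCast, zpow_natCast, ← div_eq_mul_inv]
    exact h2

theorem shiftDown_expVec (t : ℝ) (j : ℤ) : shiftDown e (expVec e t j) = expVec e t (j + 1) := by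
  have h : Commute (shiftDown e) (NormedSpace.exp (t • shiftUp e)) :=
    ((commute_shift e).smul_left t).exp_left.symm
  have h1 := congrArg (fun A : E →L[ℝ] E => A (e (-j))) h.eq
  simp only [mul_apply_eq_comp] at h1
  rw [expVec, h1, shiftDown_apply, expVec, neg_add']

theorem shiftDown_besselVec (t : ℝ) (j : ℤ) :
    shiftDown e (besselVec e t j) = besselVec e t (j + 1) := by
  have h : Commute (shiftDown e) (NormedSpace.exp (-t • shiftDown e)) :=
    ((Commute.refl (shiftDown e)).smul_left (-t)).exp_left.symm
  have h1 := congrArg (fun A : E →L[ℝ] E => A (expVec e t j)) h.eq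
  simp only [mul_apply_eq_comp] at h1
  rw [besselVec, h1, shiftDown_expVec, besselVec]

theorem hasSum_besselVec (t : ℝ) (j : ℤ) :
    HasSum (fun m : ℕ => ((-t) ^ m / (m.factorial : ℝ)) • expVec e t (j + m))
      (besselVec e t j) := by
  have h := hasSum_exp_apply (shiftDown e) (-t) (fun m => expVec e t (j + m)) fun m =>
    pow_apply_of_forall (shiftDown e) (fun m : ℕ => expVec e t (j + m))
      (fun m => by rw [shiftDown_expVec]; push_cast; ring_nf) m
  simp only [Nat.cast_zero, add_zero] at h
  exact h

theorem exp_shiftDown_besselVec (t : ℝ) (j : ℤ) :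
    NormedSpace.exp (t • shiftDown e) (besselVec e t j) = expVec e t j := by
  let _ : NormedAlgebra ℚ (E →L[ℝ] E) := NormedAlgebra.restrictScalars ℚ ℝ _
  have h : NormedSpace.exp (t • shiftDown e) * NormedSpace.exp (-t • shiftDown e) = 1 := by
    rw [← NormedSpace.exp_add_of_commute (((Commute.refl (shiftDown e)).smul_left t).smul_right _),
      ← add_smul, add_neg_cancel, zero_smul, NormedSpace.exp_zero]
  have h1 := congrArg (fun A : E →L[ℝ] E => A (expVec e t j)) h
  exact h1

theorem hasSum_expVec (t : ℝ) (j : ℤ) :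
    HasSum (fun m : ℕ => (t ^ m / (m.factorial : ℝ)) • besselVec e t (j + m)) (expVec e t j) := by
  have h := hasSum_exp_apply (shiftDown e) t (fun m => besselVec e t (j + m)) fun m =>
    pow_apply_of_forall (shiftDown e) (fun m : ℕ => besselVec e t (j + m))
      (fun m => by rw [shiftDown_besselVec]; push_cast; ring_nf) m
  simpa only [Nat.cast_zero, add_zero, exp_shiftDown_besselVec] using h

theorem inner_besselVec {t : ℝ} (ht : 0 < t) (x j : ℤ) :
    inner ℝ (e x) (besselVec e t j) = besselJ ((x + j : ℤ) : ℝ) (2 * t) := by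
  refine HasSum.unique ((innerSL ℝ (e x)).hasSum (hasSum_besselVec e t j)) ?_
  convert! hasSum_besselJ_int ht (x + j) using 1
  ext m
  simp only [innerSL_apply_apply, inner_smul_right, inner_expVec, add_assoc]

/-- The two shifts commute, so the vectors are images of basis vectors under exp(t(S - S*)), which
is unitary because its exponent is skew-adjoint. -/
theorem orthonormal_besselVec (t : ℝ) : Orthonormal ℝ (besselVec e t) := by
  let _ : NormedAlgebra ℚ (E →L[ℝ] E) := NormedAlgebra.restrictScalars ℚ ℝ _
  set U : E →L[ℝ] E := NormedSpace.exp (-t • shiftDown e + t • shiftUp e) with hU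
  have hskew : -t • shiftDown e + t • shiftUp e ∈ skewAdjoint (E →L[ℝ] E) := by
    rw [skewAdjoint.mem_iff, star_add, star_smul, star_smul, star_shiftUp, star_shiftDown]
    simp only [star_trivial, neg_smul, neg_add, neg_neg]
    exact add_comm _ _
  have hunit := NormedSpace.exp_mem_unitary_of_mem_skewAdjoint hskew
  have hvec : ∀ j, besselVec e t j = U (e (-j)) := by
    intro j
    rw [hU, NormedSpace.exp_add_of_commute
      (((commute_shift e).symm.smul_left (-t)).smul_right t)]
    rfl
  rw [orthonormal_iff_ite]
  intro i j
  rw [hvec, hvec, ContinuousLinearMap.inner_map_map_of_mem_unitary hunit,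
    orthonormal_iff_ite.1 e.orthonormal]
  simp

/-- The vectors whose coordinates are the entries of the matrices of divided powers. -/
abbrev expSeq (t : ℝ) (j : ℕ) : E := expVec e t (j + 1)

/-- The left side is a matrix coefficient of the projection onto the first N exponential vectors. In
the limit the closed span has the Bessel vectors as an orthonormal basis, whose Gram matrices are
trivial. -/
theorem tendsto_gram_expSeq {t : ℝ} (ht : 0 < t) (hG : ∀ N, IsUnit (gram (expSeq e t) N).det)
    (x y : ℤ) :
    Tendsto (fun N => (fun i : Fin N => divPow t (x + i + 1)) ⬝ᵥ
      ((gram (expSeq e t) N)⁻¹.mulVec fun j : Fin N => divPow t (y + j + 1))) atTop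
      (𝓝 (∑' j : ℕ, besselJ (x + 1 + j) (2 * t) * besselJ (y + 1 + j) (2 * t))) := by
  let w := expSeq e t
  let u : ℕ → E := fun j => besselVec e t (j + 1)
  have hcl : (⨆ N, spanFirst w N).topologicalClosure = (⨆ N, spanFirst u N).topologicalClosure := by
    refine le_antisymm (closure_spanFirst_le (c := fun m => t ^ m / (m.factorial : ℝ)) fun j => ?_)
      (closure_spanFirst_le (c := fun m => (-t) ^ m / (m.factorial : ℝ)) fun j => ?_)
    · convert! hasSum_expVec e t (j + 1) using 4
      push_cast
      ring_nf
    · convert! hasSum_besselVec e t (j + 1) using 4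
      push_cast
      ring_nf
  have hu : ∀ N, gram u N = 1 := by
    intro N
    ext i j
    rw [gram, Matrix.of_apply, orthonormal_iff_ite.1 (orthonormal_besselVec e t), Matrix.one_apply]
    simp [Fin.ext_iff]
  have h1 := Submodule.starProjection_tendsto_closure_iSup (spanFirst w) (monotone_spanFirst w)
    (e y)
  have h2 := Submodule.starProjection_tendsto_closure_iSup (spanFirst u) (monotone_spanFirst u)
    (e y)
  simp only [hcl] at h1
  have h1' := (innerSL ℝ (e x)).continuous.tendsto _ |>.comp h1
  have h2' := (innerSL ℝ (e x)).continuous.tendsto _ |>.comp h2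
  have hsum := (summable_besselJ_mul ht (x + 1) (y + 1)).hasSum.tendsto_sum_nat
  have hval : innerSL ℝ (e x) ((⨆ N, spanFirst u N).topologicalClosure.starProjection (e y)) =
      ∑' j : ℕ, besselJ (x + 1 + j) (2 * t) * besselJ (y + 1 + j) (2 * t) := by
    refine tendsto_nhds_unique h2' (hsum.congr fun N => ?_)
    rw [Function.comp_apply, innerSL_apply_apply, inner_starProjection_spanFirst u N (by simp [hu]),
      hu, inv_one, Matrix.one_mulVec, dotProduct,
      ← Fin.sum_univ_eq_sum_range fun j : ℕ =>
        besselJ (x + 1 + j) (2 * t) * besselJ (y + 1 + j) (2 * t)]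
    refine Finset.sum_congr rfl fun i _ => ?_
    rw [real_inner_comm (e y), inner_besselVec e ht, inner_besselVec e ht]
    push_cast
    ring_nf
  rw [← hval]
  refine h1'.congr fun N => ?_
  rw [Function.comp_apply, innerSL_apply_apply, inner_starProjection_spanFirst w N (hG N)]
  congr 2
  · ext i
    rw [inner_expVec, add_assoc]
  · ext j
    rw [real_inner_comm, inner_expVec, add_assoc]

end Hilbert

/-! ### Sums of products of determinants -/

theorem hasSum_prod_apply {κ : Type*} (N : ℕ) : ∀ f : Fin N → κ → ℝ, (∀ i, Summable (f i)) →
    HasSum (fun x : Fin N → κ => ∏ i, f i (x i)) (∏ i, ∑' k, f i k) := by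
  induction N with
  | zero =>
    intro f _
    simp [hasSum_unique]
  | succ N ih =>
    intro f hf
    have h1 := ih (fun i => f i.succ) fun i => hf i.succ
    obtain ⟨g, hg⟩ : ∃ g : (Fin N → κ) → ℝ, g = fun x => ∏ i, f (Fin.succ i) (x i) := ⟨_, rfl⟩
    rw [← hg] at h1
    have hs : Summable fun x : κ × (Fin N → κ) => f 0 x.1 * g x.2 :=
      summable_mul_of_summable_norm (hf 0).norm h1.summable.norm
    have h2 := (hf 0).hasSum.mul h1 hs
    rw [← (Fin.consEquiv fun _ : Fin (N + 1) => κ).hasSum_iff]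
    simpa [Function.comp_def, Fin.prod_univ_succ, hg] using h2

/-- Andréief's identity: expand both determinants, sum each coordinate separately, and note that
every σ contributes the same determinant. -/
theorem hasSum_det_mul_det {κ : Type*} {N : ℕ} (φ ψ : Fin N → κ → ℝ)
    (h : ∀ i j, Summable fun k => φ i k * ψ j k) :
    HasSum (fun x : Fin N → κ => (Matrix.of fun i j => φ j (x i)).det *
      (Matrix.of fun i j => ψ j (x i)).det)
      (N.factorial * (Matrix.of fun i j => ∑' k, φ i k * ψ j k).det) := by
  set G : Matrix (Fin N) (Fin N) ℝ := Matrix.of fun i j => ∑' k, φ i k * ψ j k with hG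
  have hdet : ∀ (χ : Fin N → κ → ℝ) (x : Fin N → κ), (Matrix.of fun i j => χ j (x i)).det =
      ∑ σ : Equiv.Perm (Fin N), ((Equiv.Perm.sign σ : ℤ) : ℝ) * ∏ i, χ (σ i) (x i) := by
    intro χ x
    rw [← Matrix.det_transpose, Matrix.det_apply']
    rfl
  have hs : HasSum (fun x : Fin N → κ => (Matrix.of fun i j => φ j (x i)).det *
      (Matrix.of fun i j => ψ j (x i)).det)
      (∑ σ : Equiv.Perm (Fin N), ∑ τ : Equiv.Perm (Fin N), ((Equiv.Perm.sign σ : ℤ) : ℝ) *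
        ((Equiv.Perm.sign τ : ℤ) : ℝ) * ∏ i, G (σ i) (τ i)) := by
    simp only [hdet, Finset.sum_mul_sum]
    refine hasSum_sum fun σ _ => hasSum_sum fun τ _ => ?_
    convert! (hasSum_prod_apply N (fun i k => φ (σ i) k * ψ (τ i) k)
      fun i => h _ _).mul_left (((Equiv.Perm.sign σ : ℤ) : ℝ) *
        ((Equiv.Perm.sign τ : ℤ) : ℝ)) using 2
    rw [Finset.prod_mul_distrib]
    ring
  convert! hs using 1
  have hσ : ∀ σ : Equiv.Perm (Fin N), ∑ τ : Equiv.Perm (Fin N), ((Equiv.Perm.sign σ : ℤ) : ℝ) *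
      ((Equiv.Perm.sign τ : ℤ) : ℝ) * ∏ i, G (σ i) (τ i) = G.det := by
    intro σ
    have h1 : ∑ τ : Equiv.Perm (Fin N), ((Equiv.Perm.sign τ : ℤ) : ℝ) * ∏ i, G (σ i) (τ i) =
        (G.submatrix σ id).det := by
      rw [← Matrix.det_transpose, Matrix.det_apply']
      rfl
    simp only [mul_assoc]
    rw [← Finset.mul_sum, h1, Matrix.det_permute, ← mul_assoc]
    rcases Int.units_eq_one_or (Equiv.Perm.sign σ) with h | h <;> simp [h]
  simp only [hσ, Finset.sum_const, Finset.card_univ, Fintype.card_perm, Fintype.card_fin,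
    nsmul_eq_mul]

theorem prod_zpow_eq_zpow_sum {ι : Type*} (s : Finset ι) (a : ι → ℤ) {t : ℝ} (ht : t ≠ 0) :
    ∏ i ∈ s, t ^ a i = t ^ ∑ i ∈ s, a i := by
  classical
  induction s using Finset.induction_on with
  | empty => simp
  | insert i s hi ih => rw [Finset.prod_insert hi, Finset.sum_insert hi, zpow_add₀ ht, ih]

theorem det_divPow {t : ℝ} (ht : t ≠ 0) {N : ℕ} (x : Fin N → ℤ) :
    (Matrix.of fun i j : Fin N => divPow t (x i + j + 1)).det = t ^ weight x * factDet x := by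
  have h : (Matrix.of fun i j : Fin N => divPow t (x i + j + 1)) =
      Matrix.of fun i j => t ^ x i * (Matrix.of fun i j : Fin N =>
        t ^ (((j : ℕ) : ℤ) + 1) * factMatrix x i j) i j := by
    ext i j
    rw [Matrix.of_apply, Matrix.of_apply, Matrix.of_apply, divPow, factMatrix, Matrix.of_apply,
      add_assoc, zpow_add₀ ht, mul_assoc]
  rw [h, Matrix.det_mul_column, Matrix.det_mul_row, ← mul_assoc, ← Finset.prod_mul_distrib,
    weight, ← prod_zpow_eq_zpow_sum _ _ ht, factDet]
  congr 1
  refine Finset.prod_congr rfl fun i _ => ?_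
  rw [← zpow_add₀ ht, add_assoc]

/-! ### The generating function for diagrams with at most `N` rows -/

/-- The weight that doubles the contribution of the points of `X`. -/
def doubling (X : Finset ℤ) (k : ℤ) : ℝ := if k ∈ X then 2 else 1

theorem poissonWeight_eq_factDet {θ : ℝ} (hθ : 0 < θ) {N : ℕ} {μ : YoungDiagram}
    (hμ : μ.rowLen N = 0) : poissonWeight θ μ =
      Real.exp (-θ) * (√θ ^ weight (descents N μ) * factDet (descents N μ)) ^ 2 := by
  have h0 : (μ.card.factorial : ℝ) ≠ 0 := by positivity
  rw [poissonWeight_eq, dim_eq_factorial_mul_factDet hμ, mul_div_cancel_left₀ _ h0,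
    weight_descents hμ, zpow_natCast, mul_pow, ← pow_mul, mul_comm μ.card, pow_mul,
    Real.sq_sqrt hθ.le, mul_assoc]

section Gram

variable {E : Type*} [NormedAddCommGroup E] [InnerProductSpace ℝ E] [CompleteSpace E]
  (e : HilbertBasis ℤ ℝ E)

theorem hasSum_gram (t : ℝ) (i j : ℕ) :
    HasSum (fun k : ℤ => divPow t (k + i + 1) * divPow t (k + j + 1))
      (inner ℝ (expSeq e t i) (expSeq e t j)) := by
  convert! e.hasSum_inner_mul_inner (expSeq e t i) (expSeq e t j) using 2 with k
  rw [real_inner_comm, inner_expVec, inner_expVec, add_assoc, add_assoc]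

/-- The correlation matrix of the first `N` rows. -/
def gramKernel (t : ℝ) (N : ℕ) (x y : ℤ) : ℝ :=
  (fun i : Fin N => divPow t (x + i + 1)) ⬝ᵥ
    ((gram (expSeq e t) N)⁻¹.mulVec fun j : Fin N => divPow t (y + j + 1))

/-- Andréief's identity with one family multiplied by the doubling weight: the extra copy of X adds
a rank-|X| term to the Gram matrix. -/
theorem hasSum_rowBounded {θ : ℝ} (hθ : 0 < θ) (N : ℕ) (X : Finset ℤ) :
    HasSum (fun μ : RowBounded N => poissonWeight θ μ * ∏ i, doubling X (descents N μ i))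
      (Real.exp (-θ) * (gram (expSeq e √θ) N + (Matrix.of fun (i : Fin N) (x : X) =>
        divPow √θ (x + i + 1)) * (Matrix.of fun (i : Fin N) (x : X) =>
          divPow √θ (x + i + 1)).transpose).det) := by
  have ht : √θ ≠ 0 := (Real.sqrt_pos.2 hθ).ne'
  let φ : Fin N → ℤ → ℝ := fun j k => divPow √θ (k + j + 1)
  let ψ : Fin N → ℤ → ℝ := fun j k => doubling X k * φ j k
  have hψ : ∀ i j : Fin N, HasSum (fun k => φ i k * ψ j k)
      (inner ℝ (expSeq e √θ i) (expSeq e √θ j) + ∑ x ∈ X, φ i x * φ j x) := by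
    intro i j
    have h2 : HasSum (fun k => if k ∈ X then φ i k * φ j k else 0) (∑ x ∈ X, φ i x * φ j x) := by
      rw [Finset.sum_congr rfl (g := fun k => if k ∈ X then φ i k * φ j k else 0)
        fun k hk => by rw [if_pos hk]]
      exact hasSum_sum_of_ne_finset_zero fun k hk => if_neg hk
    convert! (hasSum_gram e √θ i j).add h2 using 2 with k
    simp only [ψ, doubling, φ]
    split_ifs <;> ring
  have hG : (Matrix.of fun i j : Fin N => ∑' k, φ i k * ψ j k) =
      gram (expSeq e √θ) N + (Matrix.of fun (i : Fin N) (x : X) =>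
        divPow √θ (x + i + 1)) * (Matrix.of fun (i : Fin N) (x : X) =>
          divPow √θ (x + i + 1)).transpose := by
    ext i j
    rw [Matrix.of_apply, (hψ i j).tsum_eq, Matrix.add_apply, Matrix.mul_apply, gram,
      Matrix.of_apply, ← Finset.sum_coe_sort X]
    rfl
  have h := hasSum_det_mul_det φ ψ fun i j => (hψ i j).summable
  rw [hG] at h
  have hF : ∀ x : Fin N → ℤ, (Matrix.of fun i j => φ j (x i)).det *
      (Matrix.of fun i j => ψ j (x i)).det =
        (√θ ^ weight x * factDet x) ^ 2 * ∏ i, doubling X (x i) := by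
    intro x
    have h1 : (Matrix.of fun i j => ψ j (x i)).det =
        (∏ i, doubling X (x i)) * (Matrix.of fun i j => φ j (x i)).det :=
      Matrix.det_mul_column (fun i => doubling X (x i)) (Matrix.of fun i j => φ j (x i))
    have h2 : (Matrix.of fun i j => φ j (x i)).det = √θ ^ weight x * factDet x := det_divPow ht x
    rw [h1, h2]
    ring
  simp only [hF] at h
  have h3 := hasSum_descents_of_hasSum h
    (fun x σ => by
      rw [weight_comp_perm, mul_pow, factDet_sq_symm, mul_pow]
      congr 1
      exact Equiv.prod_comp σ fun i => doubling X (x i))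
    (fun x hx => by
      have h0 : factDet x ≠ 0 := fun h0 => hx (by simp [h0])
      exact ⟨injective_of_factDet_ne_zero h0, neg_le_of_factDet_ne_zero h0⟩)
  have hN : (N.factorial : ℝ) ≠ 0 := by positivity
  have h4 := (h3.mul_left (N.factorial : ℝ)⁻¹).mul_left (Real.exp (-θ))
  simp only [inv_mul_cancel_left₀ hN] at h4
  convert! h4 using 2 with μ
  rw [poissonWeight_eq_factDet hθ μ.2, mul_assoc]

theorem hasSum_rowBounded_empty {θ : ℝ} (hθ : 0 < θ) (N : ℕ) :
    HasSum (fun μ : RowBounded N => poissonWeight θ μ)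
      (Real.exp (-θ) * (gram (expSeq e √θ) N).det) := by
  have h := hasSum_rowBounded e hθ N ∅
  have h0 : (Matrix.of fun (i : Fin N) (x : (∅ : Finset ℤ)) => divPow √θ (x + i + 1)) *
      (Matrix.of fun (i : Fin N) (x : (∅ : Finset ℤ)) => divPow √θ (x + i + 1)).transpose = 0 := by
    ext i j
    simp [Matrix.mul_apply]
  rw [h0, add_zero] at h
  simpa [doubling] using h

theorem poissonWeight_nonneg {θ : ℝ} (hθ : 0 < θ) (μ : YoungDiagram) : 0 ≤ poissonWeight θ μ := by
  rw [poissonWeight_eq]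
  positivity

/-- Up to e^{-θ} the determinant is the mass of the diagrams with at most N rows, and the empty
diagram alone has positive mass. -/
theorem isUnit_det_gram {θ : ℝ} (hθ : 0 < θ) (N : ℕ) :
    IsUnit (gram (expSeq e √θ) N).det := by
  have h := hasSum_rowBounded_empty e hθ N
  have hb : (⊥ : YoungDiagram).rowLen N = 0 := rowLen_eq_zero_of_card_le
    ((card_eq_zero_iff_eq_bot.2 rfl).trans_le (Nat.zero_le N))
  have h1 := le_hasSum h (⟨⊥, hb⟩ : RowBounded N) fun μ _ => poissonWeight_nonneg hθ μ
  rw [poissonWeight_eq_factDet hθ hb, factDet_descents_bot] at h1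
  have h2 : 0 < Real.exp (-θ) * (√θ ^ weight (descents N ⊥) * 1) ^ 2 := by
    have := Real.sqrt_pos.2 hθ
    positivity
  refine isUnit_iff_ne_zero.2 fun h0 => ?_
  rw [h0, mul_zero] at h1
  exact absurd h1 (not_le.2 h2)

theorem hasSum_rowBounded_mul {θ : ℝ} (hθ : 0 < θ) (N : ℕ) (X : Finset ℤ) :
    HasSum (fun μ : RowBounded N => poissonWeight θ μ * ∏ i, doubling X (descents N μ i))
      (Real.exp (-θ) * (gram (expSeq e √θ) N).det *
        (1 + Matrix.of fun x y : X => gramKernel e √θ N x y).det) := by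
  have h := hasSum_rowBounded e hθ N X
  rw [Matrix.det_add_mul _ _ (isUnit_det_gram e hθ N), ← mul_assoc] at h
  convert! h using 4
  ext x y
  rw [Matrix.mul_assoc, Matrix.mul_apply_eq_vecMul]
  rfl

end Gram

/-! ### The limit of infinitely many rows -/

theorem hasSum_card_eq (n : ℕ) : HasSum (fun μ : {μ : YoungDiagram // μ.card = n} =>
    ((dim μ : ℝ) / (n.factorial : ℝ)) ^ 2) (1 / (n.factorial : ℝ)) := by
  have h : HasSum ({μ : YoungDiagram | μ.card = n}.indicator fun μ =>
      ((dim μ : ℝ) / (n.factorial : ℝ)) ^ 2) (1 / (n.factorial : ℝ)) := by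
    rw [← sum_factDet_sq, Finset.sum_congr rfl (g := {μ : YoungDiagram | μ.card = n}.indicator
      fun μ => ((dim μ : ℝ) / (n.factorial : ℝ)) ^ 2)]
    · refine hasSum_sum_of_ne_finset_zero fun μ hμ => Set.indicator_of_notMem ?_ _
      simpa using hμ
    · intro μ hμ
      have hc : μ.card = n := by simpa using hμ
      rw [Set.indicator_of_mem (show μ ∈ {μ : YoungDiagram | μ.card = n} from hc),
        dim_eq_factorial_mul_factDet (rowLen_eq_zero_of_card_le hc.le),
        hc, mul_div_cancel_left₀ _ (by positivity)]
  exact hasSum_subtype_iff_indicator.2 h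

theorem hasSum_poissonWeight {θ : ℝ} (hθ : 0 < θ) : HasSum (poissonWeight θ) 1 := by
  rw [← (Equiv.sigmaFiberEquiv YoungDiagram.card).hasSum_iff]
  have hfib : ∀ n, HasSum (fun μ : {μ : YoungDiagram // μ.card = n} => poissonWeight θ μ)
      (Real.exp (-θ) * (θ ^ n / (n.factorial : ℝ))) := by
    intro n
    convert! (hasSum_card_eq n).mul_left (Real.exp (-θ) * θ ^ n) using 1
    · ext μ
      rw [poissonWeight_eq, μ.2]
    · ring
  have hsum : HasSum (fun n : ℕ => Real.exp (-θ) * (θ ^ n / (n.factorial : ℝ))) 1 := by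
    have h := (NormedSpace.expSeries_div_hasSum_exp θ).mul_left (Real.exp (-θ))
    rwa [← Real.exp_eq_exp_ℝ, ← Real.exp_add, neg_add_cancel, Real.exp_zero] at h
  refine HasSum.sigma_of_hasSum hsum hfib ?_
  refine (summable_sigma_of_nonneg fun x => poissonWeight_nonneg hθ _).2
    ⟨fun n => (hfib n).summable, ?_⟩
  convert! hsum.summable using 2 with n
  exact (hfib n).tsum_eq

theorem tendsto_tsum_rowBounded {g : YoungDiagram → ℝ} (hg : Summable g) :
    Tendsto (fun N => ∑' μ : RowBounded N, g μ) atTop (𝓝 (∑' μ, g μ)) := by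
  have h : ∀ N, ∑' μ : RowBounded N, g μ =
      ∑' μ, {μ : YoungDiagram | μ.rowLen N = 0}.indicator g μ := fun N =>
    tsum_subtype {μ : YoungDiagram | μ.rowLen N = 0} g
  simp_rw [h]
  refine tendsto_tsum_of_dominated_convergence hg.norm (fun μ => ?_)
    (Eventually.of_forall fun N μ => norm_indicator_le_norm_self _ _)
  refine tendsto_const_nhds.congr' ?_
  filter_upwards [eventually_ge_atTop μ.card] with N hN
  rw [Set.indicator_of_mem (show μ ∈ {μ : YoungDiagram | μ.rowLen N = 0} from
    rowLen_eq_zero_of_card_le hN)]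

open Classical in
/-- The indicator of the points of the descent set. -/
def descentIndicator (μ : YoungDiagram) (k : ℤ) : ℝ := if k ∈ descentSet μ then 1 else 0

/-- Descents beyond the first N are smaller than -N, so they cannot meet X. -/
theorem prod_doubling_descents {N : ℕ} {μ : YoungDiagram} (hμ : μ.rowLen N = 0) {X : Finset ℤ}
    (hX : ∀ x ∈ X, -(N : ℤ) ≤ x) :
    ∏ i, doubling X (descents N μ i) = ∏ x ∈ X, (1 + descentIndicator μ x) := by
  classical
  have h1 : ∏ i, doubling X (descents N μ i) =
      ∏ k ∈ Finset.univ.image (descents N μ), doubling X k :=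
    (Finset.prod_image (descents_strictAnti N μ).injective.injOn).symm
  have h2 : ∀ x ∈ X, x ∈ descentSet μ ↔ x ∈ Finset.univ.image (descents N μ) := by
    intro x hx
    rw [Finset.mem_image]
    constructor
    · rintro ⟨i, rfl⟩
      rcases lt_or_ge i N with hi | hi
      · exact ⟨⟨i, hi⟩, Finset.mem_univ _, rfl⟩
      · have : -(N : ℤ) ≤ (μ.rowLen i : ℤ) - ((i : ℤ) + 1) := hX _ hx
        rw [rowLen_eq_zero_of_le hμ hi] at this
        omega
    · rintro ⟨i, -, rfl⟩
      exact ⟨i, rfl⟩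
  have h3 : ∏ x ∈ X, (1 + descentIndicator μ x) =
      ∏ x ∈ X, if x ∈ Finset.univ.image (descents N μ) then (2 : ℝ) else 1 := by
    refine Finset.prod_congr rfl fun x hx => ?_
    simp only [descentIndicator, h2 x hx]
    split_ifs <;> norm_num
  rw [h1, h3, Finset.prod_ite_mem]
  simp only [doubling]
  rw [Finset.prod_ite_mem, Finset.inter_comm]

theorem tsum_poissonWeight_mul_prod {θ : ℝ} (hθ : 0 < θ) (X : Finset ℤ) :
    ∑' μ, poissonWeight θ μ * ∏ x ∈ X, (1 + descentIndicator μ x) =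
      (1 + Matrix.of fun x y : X => besselKernel θ x y).det := by
  let e : HilbertBasis ℤ ℝ (lp (fun _ : ℤ => ℝ) 2) :=
    HilbertBasis.ofRepr (LinearIsometryEquiv.refl ℝ _)
  have hle : ∀ μ k, 1 + descentIndicator μ k ≤ 2 := fun μ k => by
    unfold descentIndicator
    split_ifs <;> norm_num
  have hge : ∀ μ k, 0 ≤ 1 + descentIndicator μ k := fun μ k => by
    unfold descentIndicator
    split_ifs <;> norm_num
  have hsum : Summable fun μ => poissonWeight θ μ * ∏ x ∈ X, (1 + descentIndicator μ x) := by
    refine Summable.of_nonneg_of_le (fun μ => mul_nonneg (poissonWeight_nonneg hθ μ)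
      (Finset.prod_nonneg fun x _ => hge μ x)) (fun μ => ?_)
      ((hasSum_poissonWeight hθ).summable.mul_right (2 ^ X.card))
    refine mul_le_mul_of_nonneg_left ?_ (poissonWeight_nonneg hθ μ)
    refine (Finset.prod_le_prod (fun x _ => hge μ x) fun x _ => hle μ x).trans_eq ?_
    rw [Finset.prod_const]
  have h1 := tendsto_tsum_rowBounded hsum
  have h2 := tendsto_tsum_rowBounded (hasSum_poissonWeight hθ).summable
  rw [(hasSum_poissonWeight hθ).tsum_eq] at h2
  simp_rw [(hasSum_rowBounded_empty e hθ _).tsum_eq] at h2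
  have h3 : Tendsto (fun N => (1 + Matrix.of fun x y : X => gramKernel e √θ N x y).det) atTop
      (𝓝 (1 + Matrix.of fun x y : X => besselKernel θ x y).det) := by
    have hm : Tendsto (fun N => 1 + Matrix.of fun x y : X => gramKernel e √θ N x y) atTop
        (𝓝 (1 + Matrix.of fun x y : X => besselKernel θ x y)) := by
      refine tendsto_const_nhds.add (tendsto_pi_nhds.2 fun x => tendsto_pi_nhds.2 fun y => ?_)
      rw [Matrix.of_apply, besselKernel_eq_tsum hθ]
      exact tendsto_gram_expSeq e (Real.sqrt_pos.2 hθ) (isUnit_det_gram e hθ) x y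
    exact ((continuous_id.matrix_det).tendsto _).comp hm
  -- The mass factor tends to 1, so only the Fredholm-type determinant survives.
  have h4 := h2.mul h3
  rw [one_mul] at h4
  refine tendsto_nhds_unique h1 (h4.congr' ?_)
  obtain ⟨N₀, hN₀⟩ : ∃ N₀ : ℕ, ∀ x ∈ X, -(N₀ : ℤ) ≤ x := by
    refine ⟨∑ x ∈ X, x.natAbs, fun x hx => ?_⟩
    have := Finset.single_le_sum (f := fun x : ℤ => x.natAbs) (fun _ _ => Nat.zero_le _) hx
    omega
  filter_upwards [eventually_ge_atTop N₀] with N hN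
  rw [← (hasSum_rowBounded_mul e hθ N X).tsum_eq]
  refine tsum_congr fun μ => ?_
  rw [prod_doubling_descents μ.2 fun x hx => ?_]
  have := hN₀ x hx
  omega

/-! ### Correlation functions -/

theorem correlation_eq_tsum {θ : ℝ} (hθ : 0 < θ) (Y : Finset ℤ) :
    correlation θ (Y : Set ℤ) = ∑' μ, poissonWeight θ μ * ∏ x ∈ Y, descentIndicator μ x := by
  classical
  have hprod : ∀ μ, ∏ x ∈ Y, descentIndicator μ x =
      if (Y : Set ℤ) ⊆ descentSet μ then 1 else 0 := by
    intro μ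
    simp only [descentIndicator]
    rw [Finset.prod_ite_zero, Finset.prod_const_one]
    exact if_congr Iff.rfl rfl rfl
  have hnonneg : ∀ μ, 0 ≤ poissonWeight θ μ * ∏ x ∈ Y, descentIndicator μ x := by
    intro μ
    rw [hprod]
    split_ifs
    · simpa using poissonWeight_nonneg hθ μ
    · simp
  have hsum : Summable fun μ => poissonWeight θ μ * ∏ x ∈ Y, descentIndicator μ x := by
    refine Summable.of_nonneg_of_le hnonneg (fun μ => ?_) (hasSum_poissonWeight hθ).summable
    rw [hprod]
    split_ifs
    · simp
    · simpa using poissonWeight_nonneg hθ μ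
  have hmeas : MeasurableSet {μ : YoungDiagram | (Y : Set ℤ) ⊆ descentSet μ} := trivial
  rw [correlation, Measure.real, poissonMeasure, Measure.sum_apply _ hmeas,
    ← ENNReal.toReal_ofReal (tsum_nonneg hnonneg), ENNReal.ofReal_tsum_of_nonneg hnonneg hsum]
  congr 2
  ext μ
  rw [Measure.smul_apply, Measure.dirac_apply' _ hmeas, hprod, smul_eq_mul]
  by_cases h : (Y : Set ℤ) ⊆ descentSet μ
  · rw [if_pos h, Set.indicator_of_mem (by exact h)]
    simp
  · rw [if_neg h, Set.indicator_of_notMem (by exact h)]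
    simp

/-- Multilinearity in the rows: each row comes from M or from the identity, and the identity rows
reduce the determinant to a principal minor. -/
theorem det_one_add_eq_sum {R : Type*} [CommRing R] {n : Type*} [Fintype n] [DecidableEq n]
    (M : Matrix n n R) :
    (1 + M).det = ∑ s : Finset n, (M.submatrix (Subtype.val : s → n) Subtype.val).det := by
  rw [add_comm]
  have h := Matrix.detRowAlternating.map_add_univ M (1 : Matrix n n R)
  refine Eq.trans h (Finset.sum_congr rfl fun s _ => ?_)
  exact Matrix.det_piecewise_one_eq_submatrix_det M s

theorem det_one_add_of_eq_sum_powerset (K : ℤ → ℤ → ℝ) (X : Finset ℤ) :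
    (1 + Matrix.of fun x y : X => K x y).det =
      ∑ Y ∈ X.powerset, (Matrix.of fun x y : Y => K x y).det := by
  classical
  rw [det_one_add_eq_sum]
  refine Finset.sum_bij (fun s _ => s.map (Function.Embedding.subtype _)) ?_ ?_ ?_ ?_
  · intro s _
    rw [Finset.mem_powerset]
    intro x hx
    obtain ⟨y, -, rfl⟩ := Finset.mem_map.1 hx
    exact y.2
  · intro s _ s' _ h
    exact Finset.map_injective _ h
  · intro Y hY
    exact ⟨Y.subtype (· ∈ X), Finset.mem_univ _,
      Finset.subtype_map_of_mem fun x hx => Finset.mem_powerset.1 hY hx⟩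
  · intro s _
    let f : s → (s.map (Function.Embedding.subtype _) : Finset ℤ) := fun a =>
      ⟨a.1.1, Finset.mem_map_of_mem _ a.2⟩
    have hf : Function.Bijective f := by
      constructor
      · intro a b h
        have hv := congrArg Subtype.val h
        exact Subtype.ext (Subtype.ext hv)
      · rintro ⟨x, hx⟩
        obtain ⟨y, hy, rfl⟩ := Finset.mem_map.1 hx
        exact ⟨⟨y, hy⟩, rfl⟩
    rw [← Matrix.det_submatrix_equiv_self (Equiv.ofBijective f hf)]
    rfl

theorem eq_of_sum_powerset_eq {α : Type*} [DecidableEq α] {a b : Finset α → ℝ}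
    (h : ∀ X : Finset α, ∑ Y ∈ X.powerset, a Y = ∑ Y ∈ X.powerset, b Y) (X : Finset α) :
    a X = b X := by
  induction X using Finset.strongInduction with
  | H X ih =>
    have h1 := h X
    rw [← Finset.add_sum_erase _ a (Finset.mem_powerset_self X),
      ← Finset.add_sum_erase _ b (Finset.mem_powerset_self X)] at h1
    have h2 : ∑ Y ∈ X.powerset.erase X, a Y = ∑ Y ∈ X.powerset.erase X, b Y :=
      Finset.sum_congr rfl fun Y hY => ih Y (Finset.mem_ssubsets.1 hY)
    rw [h2] at h1
    exact add_right_cancel h1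

/-- Both sides of the generating identity are sums over subsets of X, of correlations and of
principal minors. As it holds for every finite X, induction on X equates the individual terms. -/
theorem correlation_eq_det {θ : ℝ} (hθ : 0 < θ) (X : Finset ℤ) :
    correlation θ (X : Set ℤ) = (Matrix.of fun i j : X => besselKernel θ i j).det := by
  refine eq_of_sum_powerset_eq (a := fun X : Finset ℤ => correlation θ (X : Set ℤ))
    (b := fun X => (Matrix.of fun i j : X => besselKernel θ i j).det) (fun X => ?_) X
  rw [← det_one_add_of_eq_sum_powerset (fun x y => besselKernel θ x y),
    ← tsum_poissonWeight_mul_prod hθ]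
  simp_rw [correlation_eq_tsum hθ, Finset.prod_one_add, Finset.mul_sum]
  refine (Summable.tsum_finsetSum fun Y _ => ?_).symm
  have hind : ∀ μ k, 0 ≤ descentIndicator μ k ∧ descentIndicator μ k ≤ 1 := fun μ k => by
    unfold descentIndicator
    split_ifs <;> norm_num
  refine Summable.of_nonneg_of_le (fun μ => mul_nonneg (poissonWeight_nonneg hθ μ)
    (Finset.prod_nonneg fun x _ => (hind μ x).1)) (fun μ => ?_) (hasSum_poissonWeight hθ).summable
  exact mul_le_of_le_one_right (poissonWeight_nonneg hθ μ)
    (Finset.prod_le_one (fun x _ => (hind μ x).1) fun x _ => (hind μ x).2)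

end PoissonPlancherel

end

theorem mainTheorem4 (θ : ℝ) (hθ : 0 < θ) :
    (∀ x : ℤ, Tendsto (fun t : ℝ => PoissonPlancherel.kernelQuotient θ x t) (𝓝[≠] (x : ℝ))
      (𝓝 (PoissonPlancherel.besselKernel θ x x))) ∧
    ∀ X : Finset ℤ, PoissonPlancherel.correlation θ (X : Set ℤ) =
      (Matrix.of fun i j : X =>
        PoissonPlancherel.besselKernel θ (i : ℤ) (j : ℤ)).det := by
  refine ⟨fun x => ?_, PoissonPlancherel.correlation_eq_det hθ⟩
  rw [PoissonPlancherel.besselKernel_eq_tsum hθ]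
  exact PoissonPlancherel.tendsto_kernelQuotient hθ x
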